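/- Let $\mathcal C$ be a (strict) braided monoidal category with tensor product $\otimes$, unit object $K$ and braiding $c$, which admits equalizers and coequalizers. Let $H$ be an object of $\mathcal C$ with a monoid structure $(\eta,\mu)$ and a counital comagma structure $(\varepsilon,\delta)$, i.e. $\delta:H\to H\otimes H$ (not assumed coassociative) and $\varepsilon:H\to K$ satisfy $(\varepsilon\otimes H)\circ\delta=\mathrm{id}_H=(H\otimes\varepsilon)\circ\delta$. (We write $H$ for $\mathrm{id}_H$ in tensor products.) Assume (b1) $\delta\circ\mu=(\mu\otimes\mu)\circ(H\otimes c_{H,H}\otimes H)\circ(\delta\otimes\delta)$; (b2) $\varepsilon\circ\mu\circ(\mu\otimes H)=((\varepsilon\circ\mu)\otimes(\varepsilon\circ\mu))\circ(H\otimes\delta\otimes H)=((\varepsilon\circ\mu)\otimes(\varepsilon\circ\mu))\circ(H\otimes(c_{H,H}^{-1}\circ\delta)\otimes H)$; (b3) $(\delta\otimes H)\circ\delta\circ\eta=(H\otimes\delta)\circ\delta\circ\eta=(H\otimes\mu\otimes H)\circ((\delta\circ\eta)\otimes(\delta\circ\eta))=(H\otimes(\mu\circ c_{H,H}^{-1})\otimes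 H)\circ((\delta\circ\eta)\otimes(\delta\circ\eta))$. Put $$\Pi^L=((\varepsilon\circ\mu)\otimes H)\circ(H\otimes c_{H,H})\circ((\delta\circ\eta)\otimes H),\qquad \Pi^R=(H\otimes(\varepsilon\circ\mu))\circ(c_{H,H}\otimes H)\circ(H\otimes(\delta\circ\eta)),$$ $$\beta=(\mu\otimes H)\circ(H\otimes\delta),\qquad \gamma=(H\otimes\mu)\circ(\delta\otimes H),$$ and, for $\sigma\in\{L,R\}$, $$\Omega_\sigma^1=(\mu\otimes H)\circ(H\otimes\Pi^\sigma\otimes H)\circ(H\otimes\delta),\qquad \Omega_\sigma^2=(H\otimes\mu)\circ(H\otimes\Pi^\sigma\otimes H)\circ(\delta\otimes H).$$ Each $\Omega_\sigma^\alpha$ is a split idempotent: there are an object $H\times_\sigma^\alpha H$ and morphisms $q_\sigma^\alpha:H\otimes H\to H\times_\sigma^\alpha H$, $j_\sigma^\alpha:H\times_\sigma^\alpha H\to H\otimes H$ with $j_\sigma^\alpha\circ q_\sigma^\alpha=\Omega_\sigma^\alpha$ and $q_\sigma^\alpha\circ j_\sigma^\alpha=\mathrm{id}$. For every choice of these splittings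 the following are equivalent. (i) $H$ is a weak Hopf coquasigroup, i.e. besides (b1)–(b3) there is a morphism $\lambda:H\to H$ such that, with $f\ast g=\mu\circ(f\otimes g)\circ\delta$, $\Pi^L=\mathrm{id}_H\ast\lambda$, $\ \Pi^R=\lambda\ast\mathrm{id}_H$, $\ \lambda\ast\Pi^L=\Pi^R\ast\lambda=\lambda$, $(\mu\otimes H)\circ(\lambda\otimes\delta)\circ\delta=(\Pi^R\otimes H)\circ\delta$, $(\mu\otimes H)\circ(H\otimes\lambda\otimes H)\circ(H\otimes\delta)\circ\delta=(\Pi^L\otimes H)\circ\delta$, $(H\otimes\mu)\circ(\delta\otimes\lambda)\circ\delta=(H\otimes\Pi^L)\circ\delta$, and $(H\otimes\mu)\circ(H\otimes\lambda\otimes H)\circ(\delta\otimes H)\circ\delta=(H\otimes\Pi^R)\circ\delta$. (ii) The morphisms $h=q_L^2\circ\gamma\circ j_R^2:H\times_R^2H\to H\times_L^2H$ and $s=q_R^1\circ\beta\circ j_L^1:H\times_L^1H\to H\times_R^1H$ are isomorphisms; moreover $\phi=j_R^2\circ h^{-1}\circ q_L^2$ is almost left $H$-colinear, i.e. $\phi=(H\otimes\varepsilon\otimes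 H)\circ(H\otimes\phi)\circ(\delta\otimes H)$, and $\psi=j_L^1\circ s^{-1}\circ q_R^1$ is almost right $H$-colinear, i.e. $\psi=(H\otimes\varepsilon\otimes H)\circ(\psi\otimes H)\circ(H\otimes\delta)$. -/

import Mathlib

open CategoryTheory MonoidalCategory Limits
open scoped MonObj

universe v u

/-- A counital comagma in a monoidal category: an object with a coproduct (not assumed
coassociative) and a two-sided counit. -/
class CounitalComagma {C : Type u} [Category.{v} C] [MonoidalCategory C] (X : C) where
  /-- The counit. -/
  counit : X ⟶ 𝟙_ C
  /-- The coproduct. -/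
  comul : X ⟶ X ⊗ X
  counit_comul : comul ≫ counit ▷ X ≫ (λ_ X).hom = 𝟙 X
  comul_counit : comul ≫ X ◁ counit ≫ (ρ_ X).hom = 𝟙 X

notation "δ[" X "]" => @CounitalComagma.comul _ _ _ X _
notation "ε[" X "]" => @CounitalComagma.counit _ _ _ X _

/-- A splitting of an endomorphism `e`: an object together with `q : X ⟶ obj` and `j : obj ⟶ X`
such that `j ∘ q = e` and `q ∘ j = id`. -/
structure Splitting {C : Type u} [Category.{v} C] {X : C} (e : X ⟶ X) where
  /-- The image object. -/
  obj : C
  /-- The inclusion. -/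
  j : obj ⟶ X
  /-- The projection. -/
  q : X ⟶ obj
  q_j : q ≫ j = e
  j_q : j ≫ q = 𝟙 obj

namespace WeakHopf

variable {C : Type u} [Category.{v} C] [MonoidalCategory C]

/-- `φ = (H ⊗ ε ⊗ H) ∘ (H ⊗ φ) ∘ (δ ⊗ H)`. -/
def AlmostLeftColinear {H : C} [CounitalComagma H] (φ : H ⊗ H ⟶ H ⊗ H) : Prop :=
  φ = δ[H] ▷ H ≫ (α_ H H H).hom ≫ H ◁ φ ≫ H ◁ (ε[H] ▷ H) ≫ H ◁ (λ_ H).hom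

/-- `φ = (H ⊗ ε ⊗ H) ∘ (φ ⊗ H) ∘ (H ⊗ δ)`. -/
def AlmostRightColinear {H : C} [CounitalComagma H] (φ : H ⊗ H ⟶ H ⊗ H) : Prop :=
  φ = H ◁ δ[H] ≫ (α_ H H H).inv ≫ φ ▷ H ≫ (H ◁ ε[H]) ▷ H ≫ (ρ_ H).hom ▷ H

/-- The convolution product `f ∗ g = μ ∘ (f ⊗ g) ∘ δ`. -/
def conv {H : C} [MonObj H] [CounitalComagma H] (f g : H ⟶ H) : H ⟶ H :=
  δ[H] ≫ (f ⊗ₘ g) ≫ μ[H]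

variable (H : C) [MonObj H] [CounitalComagma H]

/-- The right Galois morphism `(μ ⊗ H) ∘ (H ⊗ δ)`. -/
def galoisBeta : H ⊗ H ⟶ H ⊗ H :=
  H ◁ δ[H] ≫ (α_ H H H).inv ≫ μ[H] ▷ H

/-- The left Galois morphism `(H ⊗ μ) ∘ (δ ⊗ H)`. -/
def galoisGamma : H ⊗ H ⟶ H ⊗ H :=
  δ[H] ▷ H ≫ (α_ H H H).hom ≫ H ◁ μ[H]

variable [BraidedCategory C]

/-- The target morphism `((ε ∘ μ) ⊗ H) ∘ (H ⊗ c) ∘ ((δ ∘ η) ⊗ H)`. -/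
def piL : H ⟶ H :=
  (λ_ H).inv ≫ (η[H] ≫ δ[H]) ▷ H ≫ (α_ H H H).hom ≫ H ◁ (β_ H H).hom ≫ (α_ H H H).inv ≫
    (μ[H] ≫ ε[H]) ▷ H ≫ (λ_ H).hom

/-- The source morphism `(H ⊗ (ε ∘ μ)) ∘ (c ⊗ H) ∘ (H ⊗ (δ ∘ η))`. -/
def piR : H ⟶ H :=
  (ρ_ H).inv ≫ H ◁ (η[H] ≫ δ[H]) ≫ (α_ H H H).inv ≫ (β_ H H).hom ▷ H ≫ (α_ H H H).hom ≫
    H ◁ (μ[H] ≫ ε[H]) ≫ (ρ_ H).hom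

/-- `Ω_L^1 = (μ ⊗ H) ∘ (H ⊗ Π^L ⊗ H) ∘ (H ⊗ δ)`. -/
def omegaL1 : H ⊗ H ⟶ H ⊗ H :=
  H ◁ δ[H] ≫ (α_ H H H).inv ≫ (H ◁ piL H) ▷ H ≫ μ[H] ▷ H

/-- `Ω_R^1 = (μ ⊗ H) ∘ (H ⊗ Π^R ⊗ H) ∘ (H ⊗ δ)`. -/
def omegaR1 : H ⊗ H ⟶ H ⊗ H :=
  H ◁ δ[H] ≫ (α_ H H H).inv ≫ (H ◁ piR H) ▷ H ≫ μ[H] ▷ H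

/-- `Ω_L^2 = (H ⊗ μ) ∘ (H ⊗ Π^L ⊗ H) ∘ (δ ⊗ H)`. -/
def omegaL2 : H ⊗ H ⟶ H ⊗ H :=
  δ[H] ▷ H ≫ (α_ H H H).hom ≫ H ◁ (piL H ▷ H) ≫ H ◁ μ[H]

/-- `Ω_R^2 = (H ⊗ μ) ∘ (H ⊗ Π^R ⊗ H) ∘ (δ ⊗ H)`. -/
def omegaR2 : H ⊗ H ⟶ H ⊗ H :=
  δ[H] ▷ H ≫ (α_ H H H).hom ≫ H ◁ (piR H ▷ H) ≫ H ◁ μ[H]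

/-- `δ ∘ μ = (μ ⊗ μ) ∘ δ_{H ⊗ H}`, with `δ_{H ⊗ H} = (H ⊗ c ⊗ H) ∘ (δ ⊗ δ)`. -/
def CondB1 : Prop :=
  μ[H] ≫ δ[H] = (δ[H] ⊗ₘ δ[H]) ≫ tensorμ H H H H ≫ (μ[H] ⊗ₘ μ[H])

/-- `((ε ∘ μ) ⊗ (ε ∘ μ)) ∘ (H ⊗ d ⊗ H)` for `d : H ⟶ H ⊗ H`. -/
def counitPairing (d : H ⟶ H ⊗ H) : (H ⊗ H) ⊗ H ⟶ 𝟙_ C :=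
  (H ◁ d) ▷ H ≫ (α_ H H H).inv ▷ H ≫ (α_ (H ⊗ H) H H).hom ≫
    ((μ[H] ≫ ε[H]) ⊗ₘ (μ[H] ≫ ε[H])) ≫ (λ_ (𝟙_ C)).hom

/-- `ε ∘ μ ∘ (μ ⊗ H) = ((ε ∘ μ) ⊗ (ε ∘ μ)) ∘ (H ⊗ δ ⊗ H)
= ((ε ∘ μ) ⊗ (ε ∘ μ)) ∘ (H ⊗ (c⁻¹ ∘ δ) ⊗ H)`. -/
def CondB2 : Prop :=
  μ[H] ▷ H ≫ μ[H] ≫ ε[H] = counitPairing H δ[H] ∧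
  μ[H] ▷ H ≫ μ[H] ≫ ε[H] = counitPairing H (δ[H] ≫ (β_ H H).inv)

/-- `(H ⊗ m ⊗ H) ∘ ((δ ∘ η) ⊗ (δ ∘ η))` for `m : H ⊗ H ⟶ H`. -/
def unitCopairing (m : H ⊗ H ⟶ H) : 𝟙_ C ⟶ (H ⊗ H) ⊗ H :=
  (λ_ (𝟙_ C)).inv ≫ ((η[H] ≫ δ[H]) ⊗ₘ (η[H] ≫ δ[H])) ≫ (α_ (H ⊗ H) H H).inv ≫
    (α_ H H H).hom ▷ H ≫ (H ◁ m) ▷ H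

/-- `(δ ⊗ H) ∘ δ ∘ η = (H ⊗ δ) ∘ δ ∘ η = (H ⊗ μ ⊗ H) ∘ ((δ ∘ η) ⊗ (δ ∘ η))
= (H ⊗ (μ ∘ c⁻¹) ⊗ H) ∘ ((δ ∘ η) ⊗ (δ ∘ η))`. -/
def CondB3 : Prop :=
  η[H] ≫ δ[H] ≫ δ[H] ▷ H = η[H] ≫ δ[H] ≫ H ◁ δ[H] ≫ (α_ H H H).inv ∧
  η[H] ≫ δ[H] ≫ δ[H] ▷ H = unitCopairing H μ[H] ∧
  η[H] ≫ δ[H] ≫ δ[H] ▷ H = unitCopairing H ((β_ H H).inv ≫ μ[H])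

/-- `lam` is an antipode for `H`. -/
structure IsAntipode (lam : H ⟶ H) : Prop where
  /-- `Π^L = id ∗ lam` -/
  id_conv : piL H = conv (𝟙 H) lam
  /-- `Π^R = lam ∗ id` -/
  conv_id : piR H = conv lam (𝟙 H)
  /-- `lam ∗ Π^L = lam` -/
  conv_piL : conv lam (piL H) = lam
  /-- `Π^R ∗ lam = lam` -/
  piR_conv : conv (piR H) lam = lam
  /-- `(μ ⊗ H) ∘ (lam ⊗ δ) ∘ δ = (Π^R ⊗ H) ∘ δ` -/
  left_piR : δ[H] ≫ (lam ⊗ₘ δ[H]) ≫ (α_ H H H).inv ≫ μ[H] ▷ H = δ[H] ≫ piR H ▷ H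
  /-- `(μ ⊗ H) ∘ (H ⊗ lam ⊗ H) ∘ (H ⊗ δ) ∘ δ = (Π^L ⊗ H) ∘ δ` -/
  left_piL : δ[H] ≫ H ◁ δ[H] ≫ (α_ H H H).inv ≫ (H ◁ lam) ▷ H ≫ μ[H] ▷ H = δ[H] ≫ piL H ▷ H
  /-- `(H ⊗ μ) ∘ (δ ⊗ lam) ∘ δ = (H ⊗ Π^L) ∘ δ` -/
  right_piL : δ[H] ≫ (δ[H] ⊗ₘ lam) ≫ (α_ H H H).hom ≫ H ◁ μ[H] = δ[H] ≫ H ◁ piL H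
  /-- `(H ⊗ μ) ∘ (H ⊗ lam ⊗ H) ∘ (δ ⊗ H) ∘ δ = (H ⊗ Π^R) ∘ δ` -/
  right_piR : δ[H] ≫ δ[H] ▷ H ≫ (α_ H H H).hom ≫ H ◁ (lam ▷ H) ≫ H ◁ μ[H] = δ[H] ≫ H ◁ piR H

/-- The monoid and counital comagma `H` is a weak Hopf coquasigroup. -/
structure IsWeakHopfCoquasigroup : Prop where
  condB1 : CondB1 H
  condB2 : CondB2 H
  condB3 : CondB3 H
  exists_antipode : ∃ lam : H ⟶ H, IsAntipode H lam

end WeakHopf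

/-! A left `H`-linear endomorphism of `H ⊗ H` is the same thing as a map `f : H ⟶ H ⊗ H` (`leftExt`,
`eq_leftExt`), and it is almost right colinear exactly when `f = (λ ⊗ H) ∘ δ` with `λ = (H ⊗ ε) ∘ f`
(`almostRightColinear_leftExt_iff`). In this dictionary `β` corresponds to `δ`, and `Ω_σ^1` to `(Π^σ
⊗ H) ∘ δ`. If `β'` is the extension of `(λ ⊗ H) ∘ δ`, two antipode axioms become `β' ∘ β = Ω_L^1`
and `β ∘ β' = Ω_R^1`. So an antipode yields a generalized inverse of `β`, hence an inverse of the
map `s` between the images of the idempotents. The mirror image (`rightExt`) treats `γ`, `Ω_σ^2` and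
`h`. Conversely, inverses of `s` and `h` give linear generalized inverses, almost colinearity turns
these into candidates `λ` and `λ'`, and applying the counit yields the convolution identities;
`left_antipode_eq_right` identifies the two. This needs the `Ω` to be idempotent and absorbed by `β`
and `γ`, although `δ` is not coassociative. The substitute is that `δ` reassociates once a leg is
covered by a suitable `Π` (`d_piL_d`, `d_piR_d`): maps such as `b ↦ 1₁ ⊗ b1₂` are colinear, hence
determined by their counit (`tX_eq`, `tY_eq`, `tZ_eq`). These computations take place in a
`WeakBimonad`, where tensoring with `H` is an endofunctor: associators disappear, and every identity
specializes to `H ⊗ -` and to `- ⊗ H`. -/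

/-- Image of a commutative square under an endofunctor. -/
lemma CategoryTheory.Functor.map_square {C : Type u} [Category.{v} C] {X Y Y' Z : C}
    (F : C ⥤ C) {f : X ⟶ Y} {g : Y ⟶ Z} {f' : X ⟶ Y'} {g' : Y' ⟶ Z}
    (h : f ≫ g = f' ≫ g') :
    F.map f ≫ F.map g = F.map f' ≫ F.map g' := by
  rw [← F.map_comp, h, F.map_comp]

lemma CategoryTheory.Functor.map_square_assoc {C : Type u} [Category.{v} C] {X Y Y' Z : C}
    (F : C ⥤ C) {f : X ⟶ Y} {g : Y ⟶ Z} {f' : X ⟶ Y'} {g' : Y' ⟶ Z}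
    (h : f ≫ g = f' ≫ g') {A : C} (k : F.obj Z ⟶ A) :
    F.map f ≫ F.map g ≫ k = F.map f' ≫ F.map g' ≫ k := by
  rw [← F.map_comp_assoc, h, F.map_comp_assoc]

/-! ### Weak bimonads and the coproduct of the unit. -/

/-- An endofunctor with the structure carried by tensoring with a braided weak bimonoid whose
coproduct need not be coassociative: product `m`, unit `u`, coproduct `d`, counit `e` and braiding
`c` with inverse `c'`. -/
structure WeakBimonad {C : Type u} [Category.{v} C] (T : C ⥤ C) where
  m (W : C) : T.obj (T.obj W) ⟶ T.obj W
  u (W : C) : W ⟶ T.obj W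
  d (W : C) : T.obj W ⟶ T.obj (T.obj W)
  e (W : C) : T.obj W ⟶ W
  c (W : C) : T.obj (T.obj W) ⟶ T.obj (T.obj W)
  c' (W : C) : T.obj (T.obj W) ⟶ T.obj (T.obj W)
  m_nat {V W : C} (f : V ⟶ W) : m V ≫ T.map f = T.map (T.map f) ≫ m W
  u_nat {V W : C} (f : V ⟶ W) : u V ≫ T.map f = f ≫ u W
  d_nat {V W : C} (f : V ⟶ W) : d V ≫ T.map (T.map f) = T.map f ≫ d W
  e_nat {V W : C} (f : V ⟶ W) : e V ≫ f = T.map f ≫ e W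
  c_nat {V W : C} (f : V ⟶ W) : c V ≫ T.map (T.map f) = T.map (T.map f) ≫ c W
  c_c' (W : C) : c W ≫ c' W = 𝟙 _
  c'_c (W : C) : c' W ≫ c W = 𝟙 _
  assoc (W : C) : m (T.obj W) ≫ m W = T.map (m W) ≫ m W
  u_m (W : C) : u (T.obj W) ≫ m W = 𝟙 _
  map_u_m (W : C) : T.map (u W) ≫ m W = 𝟙 _
  d_e (W : C) : d W ≫ e (T.obj W) = 𝟙 _
  d_map_e (W : C) : d W ≫ T.map (e W) = 𝟙 _
  m_c (W : C) : m (T.obj W) ≫ c W = T.map (c W) ≫ c (T.obj W) ≫ T.map (m W)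
  map_m_c (W : C) : T.map (m W) ≫ c W = c (T.obj W) ≫ T.map (c W) ≫ m (T.obj W)
  c_d (W : C) : c W ≫ d (T.obj W) = T.map (d W) ≫ c (T.obj W) ≫ T.map (c W)
  c_map_d (W : C) : c W ≫ T.map (d W) = d (T.obj W) ≫ T.map (c W) ≫ c (T.obj W)
  yang_baxter (W : C) : T.map (c W) ≫ c (T.obj W) ≫ T.map (c W) =
    c (T.obj W) ≫ T.map (c W) ≫ c (T.obj W)
  u_c (W : C) : u (T.obj W) ≫ c W = T.map (u W)
  map_u_c (W : C) : T.map (u W) ≫ c W = u (T.obj W)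
  c_e (W : C) : c W ≫ e (T.obj W) = T.map (e W)
  b1 (W : C) : m W ≫ d W = d (T.obj W) ≫ T.map (T.map (d W)) ≫ T.map (c (T.obj W)) ≫
    m (T.obj (T.obj W)) ≫ T.map (m W)
  b2 (W : C) : m (T.obj W) ≫ m W ≫ e W =
    T.map (d (T.obj W)) ≫ m (T.obj (T.obj W)) ≫ e (T.obj (T.obj W)) ≫ m W ≫ e W
  b3 (W : C) : u W ≫ d W ≫ d (T.obj W) = u W ≫ d W ≫ T.map (d W)
  b3m (W : C) : u W ≫ d W ≫ d (T.obj W) =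
    u W ≫ d W ≫ T.map (T.map (u W ≫ d W)) ≫ T.map (m (T.obj W))
  b3c (W : C) : u W ≫ d W ≫ d (T.obj W) =
    u W ≫ d W ≫ T.map (T.map (u W ≫ d W)) ≫ T.map (c' (T.obj W)) ≫ T.map (m (T.obj W))

namespace WeakBimonad

variable {C : Type u} [Category.{v} C] {T : C ⥤ C} (S : WeakBimonad T)

/-- The coproduct of the unit. -/
def i (W : C) : W ⟶ T.obj (T.obj W) := S.u W ≫ S.d W

/-- The target morphism `Π^L`. -/
def piL (W : C) : T.obj W ⟶ T.obj W :=
  S.i (T.obj W) ≫ T.map (S.c W) ≫ S.m (T.obj W) ≫ S.e (T.obj W)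

/-- The source morphism `Π^R`. -/
def piR (W : C) : T.obj W ⟶ T.obj W :=
  T.map (S.i W) ≫ S.c (T.obj W) ≫ T.map (S.m W) ≫ T.map (S.e W)

lemma i_nat {V W : C} (f : V ⟶ W) : S.i V ≫ T.map (T.map f) = f ≫ S.i W := by
  simp [i, d_nat, reassoc_of% S.u_nat]

lemma piL_nat {V W : C} (f : V ⟶ W) : S.piL V ≫ T.map f = T.map f ≫ S.piL W := by
  simp only [piL, Category.assoc, S.e_nat, reassoc_of% S.m_nat, ← reassoc_of% S.i_nat,
    ← Functor.map_comp_assoc, S.c_nat]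

/-- A strand passes the coproduct of the unit. -/
lemma map_i_c (W : C) : T.map (S.i W) ≫ S.c (T.obj W) ≫ T.map (S.c W) = S.i (T.obj W) := by
  rw [i, i, Functor.map_comp, Category.assoc, ← S.c_d, reassoc_of% S.map_u_c]

lemma i_c (W : C) : S.i (T.obj W) ≫ T.map (S.c W) ≫ S.c (T.obj W) = T.map (S.i W) := by
  rw [i, i, Functor.map_comp, Category.assoc, ← S.c_map_d, reassoc_of% S.u_c]

lemma i_c' (W : C) : S.i (T.obj W) ≫ T.map (S.c' W) ≫ S.c' (T.obj W) = T.map (S.i W) := by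
  rw [← reassoc_of% S.map_i_c, ← Functor.map_comp_assoc, S.c_c']
  simp [S.c_c']

lemma map_i_c'_eq (W : C) : T.map (S.i W) ≫ S.c' (T.obj W) = S.i (T.obj W) ≫ T.map (S.c W) := by
  rw [← i_c, Category.assoc, Category.assoc, S.c_c', Category.comp_id]

/-- `δ(1 b) = δ(b)` -/
lemma i_mul (W : C) : S.i (T.obj W) ≫ T.map (T.map (S.d W)) ≫ T.map (S.c (T.obj W)) ≫
    S.m (T.obj (T.obj W)) ≫ T.map (S.m W) = S.d W := by
  rw [i, Category.assoc, ← b1, reassoc_of% S.u_m]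

lemma mul_i (W : C) : S.d W ≫ T.map (T.map (S.i W)) ≫ T.map (S.c (T.obj W)) ≫
    S.m (T.obj (T.obj W)) ≫ T.map (S.m W) = S.d W := by
  rw [i, Functor.map_comp, Functor.map_comp, Category.assoc, reassoc_of% S.d_nat, ← b1,
    reassoc_of% S.map_u_m]


lemma i_d (W : C) : S.i W ≫ S.d (T.obj W) = S.i W ≫ T.map (S.d W) := by
  simpa [i] using S.b3 W

lemma i_map_d (W : C) : S.i W ≫ T.map (S.d W) =
    S.i W ≫ T.map (T.map (S.i W)) ≫ T.map (S.m (T.obj W)) := by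
  rw [← i_d]; simpa [i] using S.b3m W

lemma i_map_d' (W : C) : S.i W ≫ T.map (S.d W) =
    S.i W ≫ T.map (T.map (S.i W)) ≫ T.map (S.c' (T.obj W)) ≫ T.map (S.m (T.obj W)) := by
  rw [← i_d]; simpa [i] using S.b3c W

/-- Yang–Baxter conjugated by the inverse crossing; it moves the `c'` that enters through `b3c` past
a third strand. -/
lemma c'_c_c (W : C) : T.map (S.c' W) ≫ S.c (T.obj W) ≫ T.map (S.c W) =
    S.c (T.obj W) ≫ T.map (S.c W) ≫ S.c' (T.obj W) := by
  have h := congrArg (fun z ↦ T.map (S.c' W) ≫ z ≫ S.c' (T.obj W)) (S.yang_baxter W)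
  simp only [Category.assoc, S.c_c', Category.comp_id, ← Functor.map_comp_assoc, S.c'_c] at h
  simpa using h.symm

/-- `Π^L * id = id` -/
lemma d_piL_m (W : C) : S.d W ≫ S.piL (T.obj W) ≫ S.m W = 𝟙 _ := by
  simp only [piL, Category.assoc]
  rw [S.e_nat, ← reassoc_of% S.i_nat, reassoc_of% S.i_mul, d_e]

/-! ### Colinear maps built from the coproduct of the unit. -/

/-- `b ↦ 1₁ ⊗ b1₂` -/
def tX (W : C) := T.map (S.i W) ≫ S.c (T.obj W) ≫ T.map (S.m W)
/-- `b ↦ Π^L(1₁) ⊗ 1₂b` -/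
def tY (W : C) := S.i (T.obj W) ≫ S.piL (T.obj (T.obj W)) ≫ T.map (S.m W)

/-- In elements: `1₁ ⊗ δ(b1₂) = 1₁ ⊗ b₁(1'₁1₂) ⊗ b₂1'₂ = 1₁ ⊗ b₁1₂ ⊗ b₂`, by multiplicativity of
`δ`, the inverse-braided form of (b3), associativity, and `δ(b)δ(1) = δ(b)`. -/
lemma tX_d (W : C) : S.tX W ≫ T.map (S.d W) = S.d W ≫ S.tX (T.obj W) := by
  calc
    S.tX W ≫ T.map (S.d W) = T.map (S.i W) ≫ S.c (T.obj W) ≫ T.map (S.m W ≫ S.d W) := by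
      simp [tX]
    _ = T.map (S.i W) ≫ (S.c _ ≫ T.map (S.d _)) ≫ T.map (T.map (T.map (S.d _)) ≫
        T.map (S.c _) ≫ S.m _ ≫ T.map (S.m W)) := by
      rw [b1]; simp
    _ = T.map (S.i W) ≫ S.d _ ≫ T.map (S.c _) ≫ (S.c _ ≫ T.map (T.map (T.map (S.d _)))) ≫
        T.map (T.map (S.c _) ≫ S.m _ ≫ T.map (S.m W)) := by
      rw [c_map_d]; simp
    _ = T.map (S.i W) ≫ S.d _ ≫ T.map (S.c _ ≫ T.map (T.map (S.d _))) ≫ S.c _ ≫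
        T.map (T.map (S.c _) ≫ S.m _ ≫ T.map (S.m W)) := by
      rw [c_nat]; simp
    _ = S.d W ≫ T.map (T.map (S.i W ≫ T.map (S.d W))) ≫ T.map (S.c _) ≫ S.c _ ≫
        T.map (T.map (S.c _) ≫ S.m _ ≫ T.map (S.m W)) := by
      rw [c_nat]; simp [reassoc_of% S.d_nat]
    -- The form of (b3) with `c'` puts the new unit `1'₁` to the left of `1₂`, next to `b₁`, where
    -- `mul_i` can absorb it.
    _ = S.d W ≫ T.map (T.map (S.i W ≫ T.map (T.map (S.i W)) ≫ T.map (S.c' (T.obj W)))) ≫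
        T.map (T.map (T.map (S.m (T.obj W))) ≫ S.c _) ≫ S.c _ ≫
        T.map (T.map (S.c _) ≫ S.m _ ≫ T.map (S.m W)) := by
      rw [i_map_d']; simp
    _ = S.d W ≫ T.map (T.map (S.i W ≫ T.map (T.map (S.i W)) ≫ T.map (S.c' (T.obj W)))) ≫
        T.map (S.c _) ≫ S.c _ ≫
        T.map (T.map (T.map (S.m (T.obj W)) ≫ S.c _) ≫ S.m _ ≫ T.map (S.m W)) := by
      rw [← c_nat]; simp [reassoc_of% S.c_nat]
    _ = S.d W ≫ T.map (T.map (S.i W ≫ T.map (T.map (S.i W)) ≫ T.map (S.c' (T.obj W)))) ≫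
        T.map (S.c _) ≫ S.c _ ≫
        T.map (T.map (S.c _ ≫ T.map (S.c _) ≫ S.m _) ≫ S.m _ ≫ T.map (S.m W)) := by
      rw [map_m_c]
    _ = S.d W ≫ T.map (T.map (S.i W) ≫ T.map (T.map (T.map (S.i W))) ≫
          T.map (T.map (S.c' (T.obj W))) ≫ S.c _ ≫ T.map (S.c _) ≫ T.map (T.map (S.c _))) ≫ S.c _ ≫
        T.map (T.map (S.m _) ≫ S.m _ ≫ T.map (S.m W)) := by
      simp [reassoc_of% S.c_nat]
    _ = S.d W ≫ T.map (T.map (S.i W) ≫ S.c _ ≫ T.map (T.map (T.map (S.i W)) ≫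
          T.map (S.c' (T.obj W)) ≫ S.c _ ≫ T.map (S.c _))) ≫ S.c _ ≫
        T.map (T.map (S.m _) ≫ S.m _ ≫ T.map (S.m W)) := by
      simp [reassoc_of% S.c_nat]
    _ = S.d W ≫ T.map (T.map (S.i W) ≫ S.c _ ≫ T.map (T.map (T.map (S.i W)) ≫
          S.c _ ≫ T.map (S.c _) ≫ S.c' _)) ≫ S.c _ ≫
        T.map (T.map (S.m _) ≫ S.m _ ≫ T.map (S.m W)) := by
      rw [c'_c_c]
    _ = S.d W ≫ T.map ((T.map (S.i W) ≫ S.c _ ≫ T.map (S.c _)) ≫ T.map (T.map (T.map (S.i _)) ≫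
          T.map (S.c _) ≫ S.c' _)) ≫ S.c _ ≫
        T.map (T.map (S.m _) ≫ S.m _ ≫ T.map (S.m W)) := by
      rw [← reassoc_of% S.c_nat]; simp
    _ = S.d W ≫ T.map (T.map (S.i W) ≫ S.c _) ≫ T.map (S.i _ ≫ T.map (S.c' _)) ≫ S.c _ ≫
        T.map (T.map (S.m _) ≫ S.m _ ≫ T.map (S.m W)) := by
      rw [map_i_c]
      simp only [Functor.map_comp, Category.assoc]
      rw [T.map_square_assoc (S.i_nat _), T.map_square_assoc (S.i_nat _)]
    _ = S.d W ≫ T.map (T.map (S.i W) ≫ S.c _) ≫ T.map (S.i _ ≫ T.map (S.c' _) ≫ S.c' _) ≫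
        (T.map (S.c _) ≫ S.c _ ≫ T.map (S.m _)) ≫
        T.map (S.m _ ≫ T.map (S.m W)) := by
      have h (W : C) : T.map (S.c' W) ≫ T.map (S.c W) = 𝟙 _ := by
        rw [← T.map_comp, c'_c, T.map_id]
      simp only [Functor.map_comp, Category.assoc, reassoc_of% h]
      rw [T.map_square_assoc (S.assoc _)]
    _ = (S.d W ≫ T.map (T.map (S.i W)) ≫ T.map (S.c _)) ≫ T.map (T.map (S.i _)) ≫
        S.m _ ≫ S.c _ ≫ T.map (S.m _ ≫ T.map (S.m W)) := by
      rw [i_c', ← m_c]; simp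
    _ = S.d W ≫ S.tX (T.obj W) := by
      conv_rhs => rw [← mul_i]
      simp only [tX, Functor.map_comp, Category.assoc]
      rw [T.map_square_assoc (S.i_nat _).symm, ← reassoc_of% S.m_nat, ← reassoc_of% S.c_nat,
        T.map_square (S.m_nat _)]
lemma tX_map_e (W : C) : S.tX W ≫ T.map (S.e W) = S.piR W := by simp [tX, piR]

/-- A colinear map is recovered from its composite with the counit, which here is `Π^R`. -/
lemma tX_eq (W : C) : S.tX W = S.d W ≫ S.piR (T.obj W) := by
  rw [← tX_map_e, ← Category.assoc, ← tX_d, Category.assoc, ← T.map_comp, d_e]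
  simp

/-- Colinearity of `tX`, read through `tX_eq`: a partial coassociativity of `δ`. -/
lemma d_piR_d (W : C) : S.d W ≫ S.piR (T.obj W) ≫ T.map (S.d W) =
    S.d W ≫ S.d (T.obj W) ≫ S.piR (T.obj (T.obj W)) := by
  rw [← tX_eq, ← tX_d, tX_eq, Category.assoc]


/-- In elements: `δ(1₂b)` contributes `(1₂1'₁)b₁ ⊗ 1'₂b₂` by the unbraided form of (b3), and
`δ(1)δ(b) = δ(b)` removes `1'`. -/
lemma tY_d (W : C) : S.tY W ≫ T.map (S.d W) = S.d W ≫ S.tY (T.obj W) := by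
  calc
    S.tY W ≫ T.map (S.d W) = S.i _ ≫ S.piL _ ≫ T.map (S.m W ≫ S.d W) := by
      simp [tY]
    _ = (S.i _ ≫ T.map (S.d _)) ≫ S.piL _ ≫
        T.map (T.map (T.map (S.d _) ≫ S.c _) ≫ S.m _ ≫ T.map (S.m W)) := by
      rw [b1, T.map_comp (S.d _), reassoc_of% S.piL_nat]; simp
    _ = S.i _ ≫ T.map (T.map (S.i _)) ≫ S.piL _ ≫ T.map (S.m _ ≫
          T.map (T.map (S.d _) ≫ S.c _) ≫ S.m _ ≫ T.map (S.m W)) := by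
      rw [i_map_d]; simp [reassoc_of% S.piL_nat]
    _ = S.i _ ≫ S.piL _ ≫ T.map (T.map (S.i _ ≫ T.map (T.map (S.d _)) ≫ T.map (S.c _) ≫
          S.m _ ≫ T.map (S.m W)) ≫ S.m _) := by
      simp only [Functor.map_comp, Category.assoc, m_nat, reassoc_of% S.m_nat, piL_nat,
        reassoc_of% S.piL_nat]
      rw [T.map_square_assoc (S.assoc _)]
    _ = S.i _ ≫ S.piL _ ≫ T.map (T.map (S.d W) ≫ S.m _) := by
      rw [i_mul]
    _ = S.d W ≫ S.tY (T.obj W) := by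
      simp [tY, ← reassoc_of% S.i_nat, reassoc_of% S.piL_nat]

/-- (b2) with the unit in the middle: `ε(a1₁) ε(1₂b) = ε(ab)`. -/
lemma map_i_m_e_m_e (W : C) : T.map (S.i (T.obj W)) ≫ S.m (T.obj (T.obj W)) ≫
    S.e (T.obj (T.obj W)) ≫ S.m W ≫ S.e W = S.m W ≫ S.e W := by
  rw [i, Functor.map_comp, Category.assoc, ← b2, reassoc_of% S.map_u_m]

/-- A strand passes the pairing `ε ∘ μ`. -/
lemma c_m_e (W : C) : S.c (T.obj W) ≫ T.map (S.c W) ≫ S.m (T.obj W) ≫ S.e (T.obj W) =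
    T.map (S.m W) ≫ T.map (S.e W) := by
  rw [← reassoc_of% S.map_m_c, c_e]

/-- In elements: `Π^L(1₁) ε(1₂b) = ε(1'₁1₁) ε(1₂b) 1'₂ = ε(1'₁b) 1'₂`; the remaining work is moving
strands across the crossings. -/
lemma tY_map_e (W : C) : S.tY W ≫ T.map (S.e W) = S.piL W := by
  calc
    S.tY W ≫ T.map (S.e W) = S.i (T.obj W) ≫ S.i _ ≫ T.map (S.c _) ≫ S.m _ ≫ S.e _ ≫
        T.map (S.m W) ≫ T.map (S.e W) := by
      simp [tY, piL]
    _ = S.i (T.obj W) ≫ S.i _ ≫ T.map (S.c _) ≫ S.m _ ≫ S.e _ ≫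
        S.c _ ≫ T.map (S.c _) ≫ S.m _ ≫ S.e _ := by
      rw [c_m_e]
    _ = S.i (T.obj W) ≫ S.i _ ≫ T.map (S.c _ ≫ T.map (S.c _ ≫ T.map (S.c _))) ≫
        S.m _ ≫ S.e _ ≫ S.m _ ≫ S.e _ := by
      simp [reassoc_of% S.m_nat, reassoc_of% S.e_nat]
    _ = S.i (T.obj W) ≫ T.map ((T.map (S.i (T.obj W)) ≫ S.c _ ≫ T.map (S.c _)) ≫
        T.map (T.map (S.c _))) ≫
        S.m _ ≫ S.e _ ≫ S.m _ ≫ S.e _ := by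
      rw [← reassoc_of% S.i_nat]
      simp
    _ = S.i (T.obj W) ≫ T.map (S.c _ ≫ S.i _) ≫
        S.m _ ≫ S.e _ ≫ S.m _ ≫ S.e _ := by
      rw [map_i_c, i_nat]
    _ = S.piL W := by
      simp [piL, map_i_m_e_m_e]

lemma tY_eq (W : C) : S.tY W = S.d W ≫ S.piL (T.obj W) := by
  rw [← tY_map_e, ← Category.assoc, ← tY_d, Category.assoc, ← T.map_comp, d_e]
  simp

lemma d_piL_d (W : C) : S.d W ≫ S.piL (T.obj W) ≫ T.map (S.d W) =
    S.d W ≫ S.d (T.obj W) ≫ S.piL (T.obj (T.obj W)) := by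
  rw [← tY_eq, ← tY_d, tY_eq, Category.assoc]

/-- `b ↦ 1₁b ⊗ 1₂` -/
def tZ (W : C) := S.i (T.obj W) ≫ T.map (S.c W) ≫ S.m (T.obj W)

/-- In elements: `δ(1₁b) ⊗ 1₂ = 1₁b₁ ⊗ 1'₁(1₂b₂) ⊗ 1'₂`, by coassociativity on the unit and the
inverse-braided (b3); then `δ(1)δ(b) = δ(b)` leaves `b₁ ⊗ 1'₁b₂ ⊗ 1'₂`. -/
lemma tZ_d (W : C) : S.tZ W ≫ S.d (T.obj W) = S.d W ≫ T.map (S.tZ W) := by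
  calc
    S.tZ W ≫ S.d (T.obj W) = S.i _ ≫ T.map (S.c _) ≫ S.m _ ≫ S.d _ := by simp [tZ]
    _ = S.i _ ≫ T.map (S.c _) ≫ S.d _ ≫ T.map (T.map (S.d _)) ≫ T.map (S.c _) ≫ S.m _ ≫
        T.map (S.m _) := by rw [b1]
    _ = (S.i _ ≫ S.d _) ≫ T.map (T.map (S.c _ ≫ S.d _)) ≫ T.map (S.c _) ≫ S.m _ ≫
        T.map (S.m _) := by simp [reassoc_of% S.d_nat]
    _ = (S.i _ ≫ T.map (S.d _)) ≫ T.map (T.map (T.map (S.d _) ≫ S.c _ ≫ T.map (S.c _))) ≫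
        T.map (S.c _) ≫ S.m _ ≫ T.map (S.m _) := by rw [i_d, c_d]
    _ = S.i _ ≫ T.map (T.map (S.i _)) ≫ T.map (S.c' _) ≫ T.map (S.m _ ≫ T.map (T.map (S.d _) ≫
        S.c _ ≫ T.map (S.c _)) ≫ S.c _) ≫ S.m _ ≫ T.map (S.m _) := by
      rw [i_map_d']; simp
    _ = S.i _ ≫ T.map (T.map (S.i _)) ≫ T.map (S.c' _ ≫ T.map (T.map (T.map (S.d _) ≫
        S.c _ ≫ T.map (S.c _))) ≫ T.map (S.c _) ≫ S.c _ ≫ T.map (S.m _)) ≫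
          S.m _ ≫ T.map (S.m _) := by
      rw [← m_c]; simp [reassoc_of% S.m_nat]
    _ = S.i _ ≫ T.map (S.i _ ≫ T.map (S.c _)) ≫
        T.map (T.map (T.map (T.map (S.d _) ≫ S.c _ ≫ T.map (S.c _))) ≫ T.map (S.c _) ≫ S.c _ ≫
          T.map (S.m _)) ≫ S.m _ ≫ T.map (S.m _) := by
      rw [← map_i_c'_eq]; simp
    _ = S.i _ ≫ T.map (S.i _ ≫ T.map (T.map (T.map (S.d _)) ≫ (S.c _ ≫ T.map (S.c _) ≫ S.c _) ≫
          T.map (T.map (S.c _))) ≫ S.c _ ≫ T.map (S.m _)) ≫ S.m _ ≫ T.map (S.m _) := by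
      simp only [Functor.map_comp, Category.assoc]
      rw [T.map_square_assoc (T.map_square (S.c_nat (S.d W))),
        T.map_square_assoc (T.map_square (S.c_nat (S.c W)))]
    _ = S.i _ ≫ T.map (T.map (S.d _) ≫ S.c _ ≫ (S.i _ ≫ T.map (S.c _) ≫ S.c _) ≫
          T.map (T.map (S.c _) ≫ T.map (T.map (S.c _)) ≫ S.m _)) ≫ S.m _ ≫ T.map (S.m _) := by
      rw [← yang_baxter]
      simp only [Functor.map_comp, Category.assoc]
      rw [T.map_square_assoc (S.i_nat _), T.map_square_assoc (S.i_nat _)]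
      rw [T.map_square_assoc (S.c_nat _), T.map_square_assoc (S.c_nat _)]
    _ = S.i _ ≫ T.map (T.map (S.d _) ≫ S.c _ ≫ T.map (S.i _ ≫ T.map (S.c _ ≫ T.map (S.c _)))) ≫
          S.m _ ≫ T.map (T.map (S.m _) ≫ S.m _) := by
      rw [i_c, ← S.assoc]; simp [reassoc_of% S.m_nat]
    _ = (S.i _ ≫ T.map (T.map (S.d _)) ≫ T.map (S.c _) ≫ S.m _) ≫
          T.map (S.i _ ≫ T.map (T.map (S.m _) ≫ S.c _) ≫ S.m _) := by
      rw [map_m_c]; simp [reassoc_of% S.m_nat, m_nat]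
    _ = (S.i _ ≫ T.map (T.map (S.d _)) ≫ T.map (S.c _) ≫ S.m _ ≫ T.map (S.m _)) ≫
          T.map (S.i _ ≫ T.map (S.c _) ≫ S.m _) := by
      simp only [Functor.map_comp, Category.assoc]
      rw [T.map_square_assoc (S.i_nat (S.m W))]
    _ = S.d W ≫ T.map (S.tZ W) := by
      rw [i_mul]; simp [tZ]

lemma tZ_e (W : C) : S.tZ W ≫ S.e (T.obj W) = S.piL W := by simp [tZ, piL]

lemma tZ_eq (W : C) : S.tZ W = S.d W ≫ T.map (S.piL W) := by
  rw [← tZ_e, T.map_comp, ← Category.assoc, ← tZ_d, Category.assoc, d_map_e, Category.comp_id]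

/-! ### Idempotence and absorption for `Π^L` and `Π^R`. -/

/-- `δ(1) δ(1) = δ(1)` -/
lemma i_mul_i (W : C) : S.i W ≫ T.map (T.map (S.i W)) ≫ T.map (S.c (T.obj W)) ≫
    S.m (T.obj (T.obj W)) ≫ T.map (S.m W) = S.i W := by
  rw [i, Category.assoc, ← i, mul_i]
  rfl

/-- `Π^L * Π^L = Π^L` -/
lemma d_piL_piL_m (W : C) : S.d W ≫ S.piL (T.obj W) ≫ T.map (S.piL W) ≫ S.m W = S.piL W := by
  -- Replacing `b₁ ⊗ Π^L(b₂)` by `1₁b ⊗ 1₂` reduces the claim to `ε(1'₁1₁b) 1'₂1₂`, that is, to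
  -- `δ(1)δ(1) = δ(1)`.
  rw [reassoc_of% S.piL_nat, ← reassoc_of% S.tZ_eq]
  calc
    S.tZ W ≫ S.piL (T.obj W) ≫ S.m W = (S.i _ ≫ T.map (S.c _) ≫ S.m _) ≫
        (S.i _ ≫ T.map (S.c _) ≫ S.m _ ≫ S.e _) ≫ S.m W := rfl
    _ = S.i _ ≫ S.i _ ≫ T.map (T.map (T.map (S.c _)) ≫ (T.map (S.m _) ≫ S.c _)) ≫
        S.m _ ≫ S.e _ ≫ S.m W := by simp [← reassoc_of% S.i_nat]
    _ = S.i _ ≫ T.map (T.map (S.i _)) ≫ T.map (S.c _) ≫ S.m _ ≫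
        T.map (T.map (S.c _) ≫ S.c _ ≫ T.map (S.m _)) ≫ S.m _ ≫ S.e _ := by
      rw [map_m_c, reassoc_of% S.i_nat]; simp [reassoc_of% S.m_nat, e_nat]
      rw [T.map_square_assoc (S.c_nat (S.c W))]
      simp only [← reassoc_of% S.m_nat, ← reassoc_of% S.assoc]
    _ = (S.i _ ≫ T.map (T.map (S.i _)) ≫ T.map (S.c _) ≫ S.m _ ≫ T.map (S.m _)) ≫
        T.map (S.c _) ≫ S.m _ ≫ S.e _ := by
      rw [← m_c]; simp
    _ = S.piL W := by rw [i_mul_i]; rfl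

/-- `Π^R * Π^R = Π^R` -/
lemma d_piR_piR_m (W : C) : S.d W ≫ S.piR (T.obj W) ≫ T.map (S.piR W) ≫ S.m W = S.piR W := by
  rw [← reassoc_of% S.tX_eq]
  calc
    S.tX W ≫ T.map (S.piR W) ≫ S.m W = (T.map (S.i _) ≫ S.c _ ≫ T.map (S.m _)) ≫
        T.map (T.map (S.i _) ≫ S.c _ ≫ T.map (S.m _) ≫ T.map (S.e _)) ≫ S.m W := rfl
    _ = T.map (S.i _) ≫ S.c _ ≫ T.map (T.map (T.map (S.i _)) ≫ (S.m _ ≫ S.c _) ≫ T.map (S.m _) ≫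
          T.map (S.e _)) ≫ S.m W := by
      simp only [Functor.map_comp, Category.assoc]
      rw [T.map_square_assoc (S.m_nat _)]
    _ = T.map (S.i _ ≫ T.map (T.map (S.i _))) ≫ S.c _ ≫ T.map (T.map (S.c _) ≫ S.c _) ≫ S.m _ ≫
          T.map (T.map (S.m _) ≫ S.m _ ≫ S.e _) := by
      rw [m_c, ← reassoc_of% S.assoc]; simp [m_nat, reassoc_of% S.m_nat, reassoc_of% S.c_nat]
    _ = T.map (S.i _ ≫ T.map (T.map (S.i _)) ≫ T.map (S.c _)) ≫ (S.c _ ≫ T.map (S.c _) ≫ S.m _) ≫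
          T.map (T.map (S.m _) ≫ S.m _ ≫ S.e _) := by
      simp [reassoc_of% S.c_nat]
    _ = T.map (S.i _ ≫ T.map (T.map (S.i _)) ≫ T.map (S.c _) ≫ S.m _ ≫ T.map (S.m _)) ≫ S.c _ ≫
          T.map (S.m _ ≫ S.e _) := by
      rw [← map_m_c]; simp [reassoc_of% S.c_nat]
    _ = S.piR W := by rw [i_mul_i]; simp [piR]

/-- Partial coassociativity reduces this to `Π^L * id = id`. For `H ⊗ -` it gives `β ∘ Ω_L^1 = β`.
-/
lemma d_piL_m_d (W : C) : S.d W ≫ S.piL _ ≫ T.map (S.d W) ≫ S.m (T.obj W) = S.d W := by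
  have h := (reassoc_of% S.d_piL_d W) (S.m _)
  rw [h, d_piL_m, Category.comp_id]

/-- By `tX_eq` this is `δ(b)δ(1) = δ(b)`. For `H ⊗ -` it gives `Ω_R^1 ∘ β = β`. -/
lemma d_d_piR_m (W : C) : S.d W ≫ T.map (S.d W ≫ S.piR (T.obj W)) ≫ S.m (T.obj W) = S.d W := by
  conv_rhs => rw [← mul_i]
  rw [← tX_eq]
  simp [tX, m_nat]

lemma d_piL_idem (W : C) : S.d W ≫ S.piL _ ≫ T.map (S.d W ≫ S.piL (T.obj W)) ≫ S.m (T.obj W) =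
    S.d W ≫ S.piL _ := by
  have h := (reassoc_of% S.d_piL_d W) (T.map (S.piL _) ≫ S.m _)
  simp only [Functor.map_comp, Category.assoc]
  rw [h, d_piL_piL_m]

lemma d_piR_idem (W : C) : S.d W ≫ S.piR _ ≫ T.map (S.d W ≫ S.piR (T.obj W)) ≫ S.m (T.obj W) =
    S.d W ≫ S.piR _ := by
  have h := (reassoc_of% S.d_piR_d W) (T.map (S.piR _) ≫ S.m _)
  simp only [Functor.map_comp, Category.assoc]
  rw [h, d_piR_piR_m]

end WeakBimonad

/-! ### The two weak bimonads of `H`. -/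

namespace WeakHopf
variable {C : Type u} [Category.{v} C] [MonoidalCategory C]

/-- Pads an identity with arbitrary coherence isomorphisms, so that `monoidal` can match both ends
with the form required of the functor. -/
lemma coherent_whiskerRight {X Y : C} {f g : X ⟶ Y} (h : f = g) (W : C) {A B : C}
    [MonoidalCoherence A (X ⊗ W)] [MonoidalCoherence (Y ⊗ W) B] :
    (𝟙 A ⊗≫ f ▷ W ⊗≫ 𝟙 B) = 𝟙 A ⊗≫ g ▷ W ⊗≫ 𝟙 B := by rw [h]

lemma coherent_whiskerLeft {X Y : C} {f g : X ⟶ Y} (h : f = g) (W : C) {A B : C}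
    [MonoidalCoherence A (W ⊗ X)] [MonoidalCoherence (W ⊗ Y) B] :
    (𝟙 A ⊗≫ W ◁ f ⊗≫ 𝟙 B) = 𝟙 A ⊗≫ W ◁ g ⊗≫ 𝟙 B := by rw [h]

variable [BraidedCategory C] (H : C)

lemma mul_braiding [MonObj H] : μ[H] ▷ H ≫ (β_ H H).hom =
    (α_ H H H).hom ≫ H ◁ (β_ H H).hom ≫ (α_ H H H).inv ≫ (β_ H H).hom ▷ H ≫ (α_ H H H).hom ≫
      H ◁ μ[H] := by
  simp [BraidedCategory.braiding_naturality_left, BraidedCategory.braiding_tensor_left_hom]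

lemma map_mul_braiding [MonObj H] : H ◁ μ[H] ≫ (β_ H H).hom =
    (α_ H H H).inv ≫ (β_ H H).hom ▷ H ≫ (α_ H H H).hom ≫ H ◁ (β_ H H).hom ≫ (α_ H H H).inv ≫
      μ[H] ▷ H := by
  simp [BraidedCategory.braiding_naturality_right, BraidedCategory.braiding_tensor_right_hom]

lemma braiding_comul [CounitalComagma H] : (β_ H H).hom ≫ δ[H] ▷ H = H ◁ δ[H] ≫ (α_ H H H).inv ≫
    (β_ H H).hom ▷ H ≫
    (α_ H H H).hom ≫ H ◁ (β_ H H).hom ≫ (α_ H H H).inv := by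
  rw [← BraidedCategory.braiding_naturality_right, BraidedCategory.braiding_tensor_right_hom]

lemma braiding_map_comul [CounitalComagma H] : (β_ H H).hom ≫ H ◁ δ[H] = δ[H] ▷ H ≫ (α_ H H H).hom ≫
    H ◁ (β_ H H).hom ≫ (α_ H H H).inv ≫ (β_ H H).hom ▷ H ≫ (α_ H H H).hom := by
  rw [← BraidedCategory.braiding_naturality_left, BraidedCategory.braiding_tensor_left_hom]

lemma braiding_counit [CounitalComagma H] : (β_ H H).hom ≫ ε[H] ▷ H = H ◁ ε[H] ≫ (ρ_ H).hom ≫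
    (λ_ H).inv := by
  rw [← BraidedCategory.braiding_naturality_right, braiding_tensorUnit_right]

lemma braiding_map_counit [CounitalComagma H] : (β_ H H).hom ≫ H ◁ ε[H] = ε[H] ▷ H ≫
    (λ_ H).hom ≫ (ρ_ H).inv := by
  rw [← BraidedCategory.braiding_naturality_left, braiding_tensorUnit_left]

lemma unit_braiding [MonObj H] : η[H] ▷ H ≫ (β_ H H).hom = (λ_ H).hom ≫ (ρ_ H).inv ≫ H ◁ η[H] := by
  simp [BraidedCategory.braiding_naturality_left, braiding_tensorUnit_left]

lemma map_unit_braiding [MonObj H] : H ◁ η[H] ≫ (β_ H H).hom = (ρ_ H).hom ≫ (λ_ H).inv ≫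
    η[H] ▷ H := by
  simp [BraidedCategory.braiding_naturality_right, braiding_tensorUnit_right]

variable {H} [MonObj H] [CounitalComagma H]


lemma mul_mul_counit (hb2 : CondB2 H) :
    (α_ H H H).hom ≫ H ◁ μ[H] ≫ μ[H] ≫ ε[H] = counitPairing H δ[H] := by
  rw [← hb2.1, MonObj.mul_assoc_assoc]

/-- Tensoring on the left with a weak bimonoid. -/
def leftBimonad (hb1 : CondB1 H) (hb2 : CondB2 H) (hb3 : CondB3 H) :
    WeakBimonad (tensorLeft H) where
  m W := (α_ H H W).inv ≫ μ[H] ▷ W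
  u W := (λ_ W).inv ≫ η[H] ▷ W
  d W := δ[H] ▷ W ≫ (α_ H H W).hom
  e W := ε[H] ▷ W ≫ (λ_ W).hom
  c W := (α_ H H W).inv ≫ (β_ H H).hom ▷ W ≫ (α_ H H W).hom
  c' W := (α_ H H W).inv ≫ (β_ H H).inv ▷ W ≫ (α_ H H W).hom
  m_nat f := by simp [← whisker_exchange]
  u_nat f := by simp [← whisker_exchange]
  d_nat f := by simp [whisker_exchange_assoc]
  e_nat f := by simp [whisker_exchange_assoc]
  c_nat f := by
    simp only [curriedTensor_obj_obj, curriedTensor_obj_map, Category.assoc,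
      ← associator_naturality_right,
      whisker_exchange_assoc, associator_inv_naturality_right_assoc]
  c_c' W := by simp [← comp_whiskerRight_assoc]
  c'_c W := by simp [← comp_whiskerRight_assoc]
  assoc W := by
    dsimp only [curriedTensor_obj_obj, curriedTensor_obj_map]
    refine (Eq.trans ?_ (coherent_whiskerRight (MonObj.mul_assoc H) W)).trans ?_ <;> monoidal
  u_m W := by
    dsimp only [curriedTensor_obj_obj, curriedTensor_obj_map]
    refine (Eq.trans ?_ (coherent_whiskerRight (MonObj.one_mul H) W)).trans ?_ <;> monoidal
  map_u_m W := by
    dsimp only [curriedTensor_obj_obj, curriedTensor_obj_map]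
    refine (Eq.trans ?_ (coherent_whiskerRight (MonObj.mul_one H) W)).trans ?_ <;> monoidal
  d_e W := by
    dsimp only [curriedTensor_obj_obj, curriedTensor_obj_map]
    refine (Eq.trans ?_
      (coherent_whiskerRight (CounitalComagma.counit_comul (X := H)) W)).trans ?_ <;> monoidal
  d_map_e W := by
    dsimp only [curriedTensor_obj_obj, curriedTensor_obj_map]
    refine (Eq.trans ?_
      (coherent_whiskerRight (CounitalComagma.comul_counit (X := H)) W)).trans ?_ <;> monoidal
  m_c W := by
    dsimp only [curriedTensor_obj_obj, curriedTensor_obj_map]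
    refine (Eq.trans ?_ (coherent_whiskerRight (mul_braiding H) W)).trans ?_ <;> monoidal
  map_m_c W := by
    dsimp only [curriedTensor_obj_obj, curriedTensor_obj_map]
    refine (Eq.trans ?_ (coherent_whiskerRight (map_mul_braiding H) W)).trans ?_ <;> monoidal
  c_d W := by
    dsimp only [curriedTensor_obj_obj, curriedTensor_obj_map]
    refine (Eq.trans ?_ (coherent_whiskerRight (braiding_comul H) W)).trans ?_ <;> monoidal
  c_map_d W := by
    dsimp only [curriedTensor_obj_obj, curriedTensor_obj_map]
    refine (Eq.trans ?_ (coherent_whiskerRight (braiding_map_comul H) W)).trans ?_ <;> monoidal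
  yang_baxter W := by
    dsimp only [curriedTensor_obj_obj, curriedTensor_obj_map]
    refine (Eq.trans ?_
      (coherent_whiskerRight ((BraidedCategory.yang_baxter H H H).symm) W)).trans ?_ <;> monoidal
  u_c W := by
    dsimp only [curriedTensor_obj_obj, curriedTensor_obj_map]
    refine (Eq.trans ?_ (coherent_whiskerRight (unit_braiding H) W)).trans ?_ <;> monoidal
  map_u_c W := by
    dsimp only [curriedTensor_obj_obj, curriedTensor_obj_map]
    refine (Eq.trans ?_ (coherent_whiskerRight (map_unit_braiding H) W)).trans ?_ <;> monoidal
  c_e W := by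
    dsimp only [curriedTensor_obj_obj, curriedTensor_obj_map]
    refine (Eq.trans ?_ (coherent_whiskerRight (braiding_counit H) W)).trans ?_ <;> monoidal
  b1 W := by
    dsimp only [curriedTensor_obj_obj, curriedTensor_obj_map]
    refine (Eq.trans ?_ (coherent_whiskerRight (hb1) W)).trans ?_
    · monoidal
    · simp only [tensorμ, MonoidalCategory.tensorHom_def]
      monoidal
  b2 W := by
    dsimp only [curriedTensor_obj_obj, curriedTensor_obj_map]
    refine (Eq.trans ?_ (coherent_whiskerRight (hb2.1) W)).trans ?_
    · monoidal
    · simp only [counitPairing, MonoidalCategory.tensorHom_def]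
      monoidal
  b3 W := by
    dsimp only [curriedTensor_obj_obj, curriedTensor_obj_map]
    refine (Eq.trans ?_ (coherent_whiskerRight (hb3.1) W)).trans ?_ <;> monoidal
  b3m W := by
    dsimp only [curriedTensor_obj_obj, curriedTensor_obj_map]
    refine (Eq.trans ?_ (coherent_whiskerRight (hb3.2.1) W)).trans ?_
    · monoidal
    · simp only [unitCopairing, MonoidalCategory.tensorHom_def]
      monoidal
  b3c W := by
    dsimp only [curriedTensor_obj_obj, curriedTensor_obj_map]
    refine (Eq.trans ?_ (coherent_whiskerRight (hb3.2.2) W)).trans ?_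
    · monoidal
    · simp only [unitCopairing, MonoidalCategory.tensorHom_def]
      monoidal

/-- Tensoring on the right with a weak bimonoid. -/
def rightBimonad (hb1 : CondB1 H) (hb2 : CondB2 H) (hb3 : CondB3 H) :
    WeakBimonad (tensorRight H) where
  m W := (α_ W H H).hom ≫ W ◁ μ[H]
  u W := (ρ_ W).inv ≫ W ◁ η[H]
  d W := W ◁ δ[H] ≫ (α_ W H H).inv
  e W := W ◁ ε[H] ≫ (ρ_ W).hom
  c W := (α_ W H H).hom ≫ W ◁ (β_ H H).hom ≫ (α_ W H H).inv
  c' W := (α_ W H H).hom ≫ W ◁ (β_ H H).inv ≫ (α_ W H H).inv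
  m_nat f := by simp [whisker_exchange]
  u_nat f := by simp [whisker_exchange]
  d_nat f := by simp [← whisker_exchange_assoc]
  e_nat f := by simp [← whisker_exchange_assoc]
  c_nat f := by
    simp only [Functor.flip_obj_obj, Functor.flip_obj_map, curriedTensor_map_app,
      curriedTensor_obj_obj,
      Category.assoc, ← associator_inv_naturality_left,
      ← whisker_exchange_assoc, associator_naturality_left_assoc]
  c_c' W := by simp [← whiskerLeft_comp_assoc]
  c'_c W := by simp [← whiskerLeft_comp_assoc]
  assoc W := by
    dsimp only [Functor.flip_obj_obj, Functor.flip_obj_map, curriedTensor_map_app,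
      curriedTensor_obj_obj]
    refine (Eq.trans ?_ (coherent_whiskerLeft ((MonObj.mul_assoc H).symm) W)).trans ?_ <;> monoidal
  u_m W := by
    dsimp only [Functor.flip_obj_obj, Functor.flip_obj_map, curriedTensor_map_app,
      curriedTensor_obj_obj]
    refine (Eq.trans ?_ (coherent_whiskerLeft (MonObj.mul_one H) W)).trans ?_ <;> monoidal
  map_u_m W := by
    dsimp only [Functor.flip_obj_obj, Functor.flip_obj_map, curriedTensor_map_app,
      curriedTensor_obj_obj]
    refine (Eq.trans ?_ (coherent_whiskerLeft (MonObj.one_mul H) W)).trans ?_ <;> monoidal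
  d_e W := by
    dsimp only [Functor.flip_obj_obj, Functor.flip_obj_map, curriedTensor_map_app,
      curriedTensor_obj_obj]
    refine (Eq.trans ?_
      (coherent_whiskerLeft (CounitalComagma.comul_counit (X := H)) W)).trans ?_ <;> monoidal
  d_map_e W := by
    dsimp only [Functor.flip_obj_obj, Functor.flip_obj_map, curriedTensor_map_app,
      curriedTensor_obj_obj]
    refine (Eq.trans ?_
      (coherent_whiskerLeft (CounitalComagma.counit_comul (X := H)) W)).trans ?_ <;> monoidal
  m_c W := by
    dsimp only [Functor.flip_obj_obj, Functor.flip_obj_map, curriedTensor_map_app,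
      curriedTensor_obj_obj]
    refine (Eq.trans ?_ (coherent_whiskerLeft (map_mul_braiding H) W)).trans ?_ <;> monoidal
  map_m_c W := by
    dsimp only [Functor.flip_obj_obj, Functor.flip_obj_map, curriedTensor_map_app,
      curriedTensor_obj_obj]
    refine (Eq.trans ?_ (coherent_whiskerLeft (mul_braiding H) W)).trans ?_ <;> monoidal
  c_d W := by
    dsimp only [Functor.flip_obj_obj, Functor.flip_obj_map, curriedTensor_map_app,
      curriedTensor_obj_obj]
    refine (Eq.trans ?_ (coherent_whiskerLeft (braiding_map_comul H) W)).trans ?_ <;> monoidal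
  c_map_d W := by
    dsimp only [Functor.flip_obj_obj, Functor.flip_obj_map, curriedTensor_map_app,
      curriedTensor_obj_obj]
    refine (Eq.trans ?_ (coherent_whiskerLeft (braiding_comul H) W)).trans ?_ <;> monoidal
  yang_baxter W := by
    dsimp only [Functor.flip_obj_obj, Functor.flip_obj_map, curriedTensor_map_app,
      curriedTensor_obj_obj]
    refine (Eq.trans ?_
      (coherent_whiskerLeft (BraidedCategory.yang_baxter H H H) W)).trans ?_ <;> monoidal
  u_c W := by
    dsimp only [Functor.flip_obj_obj, Functor.flip_obj_map, curriedTensor_map_app,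
      curriedTensor_obj_obj]
    refine (Eq.trans ?_ (coherent_whiskerLeft (map_unit_braiding H) W)).trans ?_ <;> monoidal
  map_u_c W := by
    dsimp only [Functor.flip_obj_obj, Functor.flip_obj_map, curriedTensor_map_app,
      curriedTensor_obj_obj]
    refine (Eq.trans ?_ (coherent_whiskerLeft (unit_braiding H) W)).trans ?_ <;> monoidal
  c_e W := by
    dsimp only [Functor.flip_obj_obj, Functor.flip_obj_map, curriedTensor_map_app,
      curriedTensor_obj_obj]
    refine (Eq.trans ?_ (coherent_whiskerLeft (braiding_map_counit H) W)).trans ?_ <;> monoidal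
  b1 W := by
    dsimp only [Functor.flip_obj_obj, Functor.flip_obj_map, curriedTensor_map_app,
      curriedTensor_obj_obj]
    refine (Eq.trans ?_ (coherent_whiskerLeft (hb1) W)).trans ?_
    · monoidal
    · simp only [tensorμ, MonoidalCategory.tensorHom_def']
      monoidal
  b2 W := by
    dsimp only [Functor.flip_obj_obj, Functor.flip_obj_map, curriedTensor_map_app,
      curriedTensor_obj_obj]
    refine (Eq.trans ?_ (coherent_whiskerLeft (mul_mul_counit hb2) W)).trans ?_
    · monoidal
    · simp only [counitPairing, MonoidalCategory.tensorHom_def']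
      monoidal
  b3 W := by
    dsimp only [Functor.flip_obj_obj, Functor.flip_obj_map, curriedTensor_map_app,
      curriedTensor_obj_obj]
    refine (Eq.trans ?_ (coherent_whiskerLeft (hb3.1.symm) W)).trans ?_ <;> monoidal
  b3m W := by
    dsimp only [Functor.flip_obj_obj, Functor.flip_obj_map, curriedTensor_map_app,
      curriedTensor_obj_obj]
    -- In mirror order the left side is `(H ⊗ δ) ∘ δ ∘ η`, so coassociativity on the unit comes
    -- first.
    refine (Eq.trans ?_ (coherent_whiskerLeft (hb3.1.symm.trans hb3.2.1) W)).trans ?_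
    · monoidal
    · simp only [unitCopairing, MonoidalCategory.tensorHom_def']
      monoidal
  b3c W := by
    dsimp only [Functor.flip_obj_obj, Functor.flip_obj_map, curriedTensor_map_app,
      curriedTensor_obj_obj]
    refine (Eq.trans ?_ (coherent_whiskerLeft (hb3.1.symm.trans hb3.2.2) W)).trans ?_
    · monoidal
    · simp only [unitCopairing, MonoidalCategory.tensorHom_def']
      monoidal

end WeakHopf

/-! ### Transfer of the identities to `H`. -/

namespace WeakHopf
lemma coherent_comp {C : Type u} [Category.{v} C] {X Y : C} {f g : X ⟶ Y} (h : f = g) {A B : C}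
    [MonoidalCoherence A X] [MonoidalCoherence Y B] :
    (𝟙 A ⊗≫ f ⊗≫ 𝟙 B) = 𝟙 A ⊗≫ g ⊗≫ 𝟙 B := by rw [h]

variable {C : Type u} [Category.{v} C] [MonoidalCategory C]

/-- The left `H`-linear extension of `f` to `H ⊗ H`. -/
def leftExt {H : C} [MonObj H] (f : H ⟶ H ⊗ H) : H ⊗ H ⟶ H ⊗ H :=
  H ◁ f ≫ (α_ H H H).inv ≫ μ[H] ▷ H

/-- The right `H`-linear extension of `f` to `H ⊗ H`. -/
def rightExt {H : C} [MonObj H] (f : H ⟶ H ⊗ H) : H ⊗ H ⟶ H ⊗ H :=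
  f ▷ H ≫ (α_ H H H).hom ≫ H ◁ μ[H]

variable [BraidedCategory C] {H : C} [MonObj H] [CounitalComagma H]

section
variable (hb1 : CondB1 H) (hb2 : CondB2 H) (hb3 : CondB3 H)

lemma leftBimonad_piL (W : C) : (leftBimonad hb1 hb2 hb3).piL W = piL H ▷ W := by
  dsimp only [WeakBimonad.piL, WeakBimonad.i, leftBimonad, piL, curriedTensor_obj_obj,
    curriedTensor_obj_map]
  monoidal

lemma leftBimonad_piR (W : C) : (leftBimonad hb1 hb2 hb3).piR W = piR H ▷ W := by
  dsimp only [WeakBimonad.piR, WeakBimonad.i, leftBimonad, piR, curriedTensor_obj_obj,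
    curriedTensor_obj_map]
  monoidal

/-- Reversing the tensor factors exchanges the target and source morphisms. -/
lemma rightBimonad_piL (W : C) : (rightBimonad hb1 hb2 hb3).piL W = W ◁ piR H := by
  dsimp only [WeakBimonad.piL, WeakBimonad.i, rightBimonad, piR, Functor.flip_obj_obj,
    Functor.flip_obj_map, curriedTensor_map_app, curriedTensor_obj_obj]
  monoidal

lemma rightBimonad_piR (W : C) : (rightBimonad hb1 hb2 hb3).piR W = W ◁ piL H := by
  dsimp only [WeakBimonad.piR, WeakBimonad.i, rightBimonad, piL, Functor.flip_obj_obj,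
    Functor.flip_obj_map, curriedTensor_map_app, curriedTensor_obj_obj]
  monoidal

include hb1 hb2 hb3

lemma comul_piL_leftExt_comul :
    (δ[H] ≫ piL H ▷ H) ≫ leftExt δ[H] = δ[H] := by
  -- Whiskering with the unit object turns the goal into the bimonad identity at `𝟙_ C`, up to
  -- coherence.
  rw [← whiskerRight_iff]
  have h := (leftBimonad hb1 hb2 hb3).d_piL_m_d (𝟙_ C)
  simp only [leftBimonad_piL] at h
  dsimp only [leftBimonad, leftExt, curriedTensor_obj_obj,
    curriedTensor_obj_map] at h ⊢
  refine (Eq.trans ?_ (coherent_comp h)).trans ?_ <;> monoidal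

lemma comul_leftExt_piR :
    δ[H] ≫ leftExt (δ[H] ≫ piR H ▷ H) = δ[H] := by
  rw [← whiskerRight_iff]
  have h := (leftBimonad hb1 hb2 hb3).d_d_piR_m (𝟙_ C)
  simp only [leftBimonad_piR] at h
  dsimp only [leftBimonad, leftExt, curriedTensor_obj_obj,
    curriedTensor_obj_map] at h ⊢
  refine (Eq.trans ?_ (coherent_comp h)).trans ?_ <;> monoidal

lemma comul_piL_leftExt_self :
    (δ[H] ≫ piL H ▷ H) ≫ leftExt (δ[H] ≫ piL H ▷ H) = δ[H] ≫ piL H ▷ H := by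
  rw [← whiskerRight_iff]
  have h := (leftBimonad hb1 hb2 hb3).d_piL_idem (𝟙_ C)
  simp only [leftBimonad_piL] at h
  dsimp only [leftBimonad, leftExt, curriedTensor_obj_obj,
    curriedTensor_obj_map] at h ⊢
  refine (Eq.trans ?_ (coherent_comp h)).trans ?_ <;> monoidal

lemma comul_piR_leftExt_self :
    (δ[H] ≫ piR H ▷ H) ≫ leftExt (δ[H] ≫ piR H ▷ H) = δ[H] ≫ piR H ▷ H := by
  rw [← whiskerRight_iff]
  have h := (leftBimonad hb1 hb2 hb3).d_piR_idem (𝟙_ C)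
  simp only [leftBimonad_piR] at h
  dsimp only [leftBimonad, leftExt, curriedTensor_obj_obj,
    curriedTensor_obj_map] at h ⊢
  refine (Eq.trans ?_ (coherent_comp h)).trans ?_ <;> monoidal

lemma comul_piR_rightExt_comul :
    (δ[H] ≫ H ◁ piR H) ≫ rightExt δ[H] = δ[H] := by
  rw [← whiskerLeft_iff]
  have h := (rightBimonad hb1 hb2 hb3).d_piL_m_d (𝟙_ C)
  simp only [rightBimonad_piL] at h
  dsimp only [rightBimonad, rightExt, Functor.flip_obj_obj,
    Functor.flip_obj_map, curriedTensor_map_app, curriedTensor_obj_obj] at h ⊢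
  refine (Eq.trans ?_ (coherent_comp h)).trans ?_ <;> monoidal

lemma comul_rightExt_piL :
    δ[H] ≫ rightExt (δ[H] ≫ H ◁ piL H) = δ[H] := by
  rw [← whiskerLeft_iff]
  have h := (rightBimonad hb1 hb2 hb3).d_d_piR_m (𝟙_ C)
  simp only [rightBimonad_piR] at h
  dsimp only [rightBimonad, rightExt, Functor.flip_obj_obj,
    Functor.flip_obj_map, curriedTensor_map_app, curriedTensor_obj_obj] at h ⊢
  refine (Eq.trans ?_ (coherent_comp h)).trans ?_ <;> monoidal

lemma comul_piR_rightExt_self :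
    (δ[H] ≫ H ◁ piR H) ≫ rightExt (δ[H] ≫ H ◁ piR H) = δ[H] ≫ H ◁ piR H := by
  rw [← whiskerLeft_iff]
  have h := (rightBimonad hb1 hb2 hb3).d_piL_idem (𝟙_ C)
  simp only [rightBimonad_piL] at h
  dsimp only [rightBimonad, rightExt, Functor.flip_obj_obj,
    Functor.flip_obj_map, curriedTensor_map_app, curriedTensor_obj_obj] at h ⊢
  refine (Eq.trans ?_ (coherent_comp h)).trans ?_ <;> monoidal

lemma comul_piL_rightExt_self :
    (δ[H] ≫ H ◁ piL H) ≫ rightExt (δ[H] ≫ H ◁ piL H) = δ[H] ≫ H ◁ piL H := by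
  rw [← whiskerLeft_iff]
  have h := (rightBimonad hb1 hb2 hb3).d_piR_idem (𝟙_ C)
  simp only [rightBimonad_piR] at h
  dsimp only [rightBimonad, rightExt, Functor.flip_obj_obj,
    Functor.flip_obj_map, curriedTensor_map_app, curriedTensor_obj_obj] at h ⊢
  refine (Eq.trans ?_ (coherent_comp h)).trans ?_ <;> monoidal

lemma comul_piR_map_comul : δ[H] ≫ piR H ▷ H ≫ H ◁ δ[H] =
    δ[H] ≫ (δ[H] ≫ piR H ▷ H) ▷ H ≫ (α_ H H H).hom := by
  rw [← whiskerRight_iff]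
  have h := (leftBimonad hb1 hb2 hb3).d_piR_d (𝟙_ C)
  simp only [leftBimonad_piR] at h
  dsimp only [leftBimonad, curriedTensor_obj_obj, curriedTensor_obj_map] at h ⊢
  refine (Eq.trans ?_ (coherent_comp h)).trans ?_ <;> monoidal

lemma comul_piL_comul_map : δ[H] ≫ H ◁ piL H ≫ δ[H] ▷ H =
    δ[H] ≫ H ◁ (δ[H] ≫ H ◁ piL H) ≫ (α_ H H H).inv := by
  rw [← whiskerLeft_iff]
  have h := (rightBimonad hb1 hb2 hb3).d_piR_d (𝟙_ C)
  simp only [rightBimonad_piR] at h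
  dsimp only [rightBimonad, Functor.flip_obj_obj, Functor.flip_obj_map, curriedTensor_map_app,
    curriedTensor_obj_obj] at h ⊢
  refine (Eq.trans ?_ (coherent_comp h)).trans ?_ <;> monoidal

end
end WeakHopf

/-! ### Split idempotents and generalized inverses. -/

section Splittings

variable {C : Type u} [Category.{v} C]

/-- The image of an idempotent is its equalizer with the identity. -/
lemma Splitting.nonempty_of_idem [HasEqualizers C] {X : C} {e : X ⟶ X} (he : e ≫ e = e) :
    Nonempty (Splitting e) :=
  ⟨{ obj := equalizer (𝟙 X) e
     j := equalizer.ι _ _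
     q := equalizer.lift e (by simp [he])
     q_j := by simp
     j_q := by
      ext
      have h := equalizer.condition (𝟙 X) e
      simpa using h.symm }⟩

lemma Splitting.q_comp {X : C} {e : X ⟶ X} (E : Splitting e) : e ≫ E.q = E.q := by
  have h := E.q_j =≫ E.q
  rw [← h, Category.assoc, E.j_q, Category.comp_id]

lemma Splitting.j_comp {X : C} {e : X ⟶ X} (E : Splitting e) : E.j ≫ e = E.j := by
  have h := E.j ≫= E.q_j
  rw [← h, reassoc_of% E.j_q]

variable {X : C} {e f b b' : X ⟶ X}

/-- A morphism between the images of two idempotents is invertible if it comes from a morphism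
with a generalized inverse. -/
lemma exists_isIso_of_generalizedInverse (E : Splitting e) (F : Splitting f)
    (h : b ≫ b' = e) (h' : b' ≫ b = f) (hb' : f ≫ b' = b') :
    ∃ _ : IsIso (E.j ≫ b ≫ F.q), F.q ≫ inv (E.j ≫ b ≫ F.q) ≫ E.j = b' := by
  have key : (E.j ≫ b ≫ F.q) ≫ F.j ≫ b' ≫ E.q = 𝟙 _ := by
    simp only [Category.assoc, reassoc_of% F.q_j, reassoc_of% hb', reassoc_of% h, E.q_comp, E.j_q]
  have key' : (F.j ≫ b' ≫ E.q) ≫ E.j ≫ b ≫ F.q = 𝟙 _ := by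
    simp only [Category.assoc, reassoc_of% E.q_j]
    rw [← h, Category.assoc, reassoc_of% h', reassoc_of% h', F.q_comp, reassoc_of% F.j_comp, F.j_q]
  have hi : IsIso (E.j ≫ b ≫ F.q) := ⟨_, key, key'⟩
  refine ⟨hi, ?_⟩
  rw [IsIso.inv_eq_of_hom_inv_id key]
  simp only [Category.assoc, reassoc_of% F.q_j, E.q_j]
  rw [← h, reassoc_of% h', hb', hb']

/-- The generalized inverse induced by an isomorphism between the images of two idempotents. -/
lemma generalizedInverse_of_isIso (E : Splitting e) (F : Splitting f) (h : e ≫ b = b)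
    (h' : b ≫ f = b) [IsIso (E.j ≫ b ≫ F.q)] :
    b ≫ F.q ≫ inv (E.j ≫ b ≫ F.q) ≫ E.j = e ∧
      (F.q ≫ inv (E.j ≫ b ≫ F.q) ≫ E.j) ≫ b = f := by
  have hb : E.q ≫ (E.j ≫ b ≫ F.q) ≫ F.j = b := by
    simp only [Category.assoc, F.q_j, h', reassoc_of% E.q_j, h]
  generalize hs : E.j ≫ b ≫ F.q = s at *
  constructor
  · rw [← hb]
    simp [reassoc_of% F.j_q, E.q_j]
  · rw [← hb]
    simp [reassoc_of% E.j_q, F.q_j]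

/-- A generalized inverse of a linear morphism is linear. -/
lemma linear_of_generalizedInverse (T : C ⥤ C) {e f b ψ : X ⟶ X} {act : T.obj X ⟶ X}
    (he : act ≫ e = T.map e ≫ act) (hf : act ≫ f = T.map f ≫ act)
    (hb : act ≫ b = T.map b ≫ act)
    (h : b ≫ ψ = e) (h' : ψ ≫ b = f) (hf' : f ≫ ψ = ψ) (he' : ψ ≫ e = ψ) :
    act ≫ ψ = T.map ψ ≫ act := by
  -- Expand `ψ` as `ψ ≫ b ≫ ψ`: the action moves past `f = ψ ≫ b`, back through `b`, and then past
  -- `e = b ≫ ψ`.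
  rw [← hf', reassoc_of% hf, ← h', T.map_comp_assoc, ← reassoc_of% hb, h, he,
    ← T.map_comp_assoc, he', h', hf']

end Splittings

/-! ### Left linear maps, `β`, and the left antipode candidate. -/

namespace WeakHopf
variable {C : Type u} [Category.{v} C] [MonoidalCategory C] {H : C}

section Ext
variable [MonObj H]

lemma unit_leftExt (f : H ⟶ H ⊗ H) : (λ_ H).inv ≫ η[H] ▷ H ≫ leftExt f = f := by
  calc
    _ = f ≫ (λ_ _).inv ≫ (η[H] ▷ (H ⊗ H) ≫ (α_ H H H).inv ≫ μ[H] ▷ H) := by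
      simp [leftExt, ← whisker_exchange_assoc]
    _ = f := by
      rw [associator_inv_naturality_left_assoc, ← comp_whiskerRight, MonObj.one_mul]
      simp

lemma leftExt_injective {f g : H ⟶ H ⊗ H} (h : leftExt f = leftExt g) : f = g := by
  rw [← unit_leftExt f, h, unit_leftExt]

lemma leftExt_linear (f : H ⟶ H ⊗ H) : ((α_ H H H).inv ≫ μ[H] ▷ H) ≫ leftExt f =
    H ◁ leftExt f ≫ (α_ H H H).inv ≫ μ[H] ▷ H := by
  calc
    _ = 𝟙 _ ⊗≫ (μ[H] ▷ H ≫ H ◁ f) ⊗≫ μ[H] ▷ H ⊗≫ 𝟙 _ := by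
      dsimp only [leftExt]; monoidal
    _ = 𝟙 _ ⊗≫ H ◁ H ◁ f ⊗≫ (μ[H] ▷ H ≫ μ[H]) ▷ H ⊗≫ 𝟙 _ := by
      rw [← whisker_exchange]; monoidal
    _ = _ := by
      rw [MonObj.mul_assoc]
      dsimp only [leftExt]; monoidal

lemma eq_leftExt {ψ : H ⊗ H ⟶ H ⊗ H} (h : ((α_ H H H).inv ≫ μ[H] ▷ H) ≫ ψ =
    H ◁ ψ ≫ (α_ H H H).inv ≫ μ[H] ▷ H) : ψ = leftExt ((λ_ H).inv ≫ η[H] ▷ H ≫ ψ) := by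
  calc
    ψ = 𝟙 _ ⊗≫ (H ◁ η[H] ≫ μ[H]) ▷ H ⊗≫ ψ := by
      rw [MonObj.mul_one]; monoidal
    _ = 𝟙 _ ⊗≫ H ◁ (η[H] ▷ H) ≫ ((α_ H H H).inv ≫ μ[H] ▷ H) ≫ ψ := by monoidal
    _ = _ := by rw [h]; dsimp only [leftExt]; monoidal

/-- Kleisli composition: it reduces identities between `β`, the `Ω_σ^1` and the antipode extension
to identities of maps out of `H`. -/
lemma leftExt_comp (f g : H ⟶ H ⊗ H) : leftExt f ≫ leftExt g = leftExt (f ≫ leftExt g) := by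
  have h := leftExt_linear g
  rw [leftExt, Category.assoc, h, ← whiskerLeft_comp_assoc]
  rfl

end Ext

section LeftExt
variable [MonObj H] [CounitalComagma H]

lemma leftExt_counit (f : H ⟶ H ⊗ H) : leftExt f ≫ H ◁ ε[H] ≫ (ρ_ H).hom =
    H ◁ (f ≫ H ◁ ε[H] ≫ (ρ_ H).hom) ≫ μ[H] := by
  calc
    _ = H ◁ f ⊗≫ (μ[H] ▷ H ≫ H ◁ ε[H]) ⊗≫ 𝟙 _ := by
      dsimp only [leftExt]; monoidal
    _ = _ := by rw [← whisker_exchange]; monoidal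

omit [MonObj H] in
lemma comul_whiskerRight_counit (g : H ⟶ H) :
    (δ[H] ≫ g ▷ H) ≫ H ◁ ε[H] ≫ (ρ_ H).hom = g := by
  rw [Category.assoc, ← whisker_exchange_assoc, rightUnitor_naturality,
    reassoc_of% CounitalComagma.comul_counit (X := H)]

/-- Applying the counit to a composite of extensions gives a convolution product; this is how the
convolution axioms are extracted. -/
lemma comul_leftExt_counit (f g : H ⟶ H) :
    ((δ[H] ≫ f ▷ H) ≫ leftExt (δ[H] ≫ g ▷ H)) ≫ H ◁ ε[H] ≫ (ρ_ H).hom = conv f g := by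
  rw [Category.assoc, leftExt_counit, comul_whiskerRight_counit, conv,
    MonoidalCategory.tensorHom_def]
  simp

/-- The colinearized map is again an extension, because `H ⊗ ε` is left linear; injectivity of
`leftExt` then compares the two. -/
lemma almostRightColinear_leftExt_iff (f : H ⟶ H ⊗ H) : AlmostRightColinear (leftExt f) ↔
    f = δ[H] ≫ (f ≫ H ◁ ε[H] ≫ (ρ_ H).hom) ▷ H := by
  have h : H ◁ δ[H] ≫ (α_ H H H).inv ≫ leftExt f ▷ H ≫ (H ◁ ε[H]) ▷ H ≫ (ρ_ H).hom ▷ H =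
      leftExt (δ[H] ≫ (f ≫ H ◁ ε[H] ≫ (ρ_ H).hom) ▷ H) := by
    rw [← comp_whiskerRight, ← comp_whiskerRight, leftExt_counit]
    dsimp only [leftExt]; monoidal
  rw [AlmostRightColinear, h]
  exact ⟨leftExt_injective, congrArg leftExt⟩

lemma galoisBeta_eq : galoisBeta H = leftExt δ[H] := rfl

variable [BraidedCategory C]

lemma omegaL1_eq : omegaL1 H = leftExt (δ[H] ≫ piL H ▷ H) := by
  dsimp only [omegaL1, leftExt]; monoidal

lemma omegaR1_eq : omegaR1 H = leftExt (δ[H] ≫ piR H ▷ H) := by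
  dsimp only [omegaR1, leftExt]; monoidal

lemma left_piL_iff (lam : H ⟶ H) : (δ[H] ≫ H ◁ δ[H] ≫ (α_ H H H).inv ≫ (H ◁ lam) ▷ H ≫
    μ[H] ▷ H = δ[H] ≫ piL H ▷ H) ↔ δ[H] ≫ leftExt (δ[H] ≫ lam ▷ H) = δ[H] ≫ piL H ▷ H := by
  simp [leftExt]

lemma left_piR_iff (lam : H ⟶ H) : (δ[H] ≫ (lam ⊗ₘ δ[H]) ≫ (α_ H H H).inv ≫ μ[H] ▷ H =
    δ[H] ≫ piR H ▷ H) ↔ (δ[H] ≫ lam ▷ H) ≫ leftExt δ[H] = δ[H] ≫ piR H ▷ H := by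
  simp [leftExt, MonoidalCategory.tensorHom_def]

variable (hb1 : CondB1 H) (hb2 : CondB2 H) (hb3 : CondB3 H)
include hb1 hb2 hb3

/-- Partial coassociativity under `Π^R` gathers the first leg into `Π^R * lam`. It supplies the
condition that `Ω_R^1` fixes the generalized inverse. -/
lemma comul_piR_leftExt {lam : H ⟶ H} (h : conv (piR H) lam = lam) :
    (δ[H] ≫ piR H ▷ H) ≫ leftExt (δ[H] ≫ lam ▷ H) = δ[H] ≫ lam ▷ H := by
  have h₁ := comul_piR_map_comul hb1 hb2 hb3 =≫ (H ◁ (lam ▷ H) ≫ (α_ H H H).inv ≫ μ[H] ▷ H)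
  simp only [Category.assoc] at h₁
  conv_rhs => rw [← h, conv, MonoidalCategory.tensorHom_def]
  simp only [leftExt, whiskerLeft_comp, Category.assoc, h₁]
  monoidal

lemma exists_isIso_of_isAntipode_left (L1 : Splitting (omegaL1 H)) (R1 : Splitting (omegaR1 H))
    {lam : H ⟶ H} (hl : IsAntipode H lam) :
    ∃ _ : IsIso (L1.j ≫ galoisBeta H ≫ R1.q),
      AlmostRightColinear (R1.q ≫ inv (L1.j ≫ galoisBeta H ≫ R1.q) ≫ L1.j) := by
  obtain ⟨hi, h⟩ := exists_isIso_of_generalizedInverse (b := galoisBeta H)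
    (b' := leftExt (δ[H] ≫ lam ▷ H)) L1 R1
    (by rw [galoisBeta_eq, leftExt_comp, (left_piL_iff lam).1 hl.left_piL, omegaL1_eq])
    (by rw [galoisBeta_eq, leftExt_comp, (left_piR_iff lam).1 hl.left_piR, omegaR1_eq])
    (by rw [omegaR1_eq, leftExt_comp, comul_piR_leftExt hb1 hb2 hb3 hl.piR_conv])
  refine ⟨hi, ?_⟩
  rw [h, almostRightColinear_leftExt_iff, comul_whiskerRight_counit]

lemma exists_antipode_left (L1 : Splitting (omegaL1 H)) (R1 : Splitting (omegaR1 H))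
    [IsIso (L1.j ≫ galoisBeta H ≫ R1.q)]
    (h : AlmostRightColinear (R1.q ≫ inv (L1.j ≫ galoisBeta H ≫ R1.q) ≫ L1.j)) :
    ∃ lam : H ⟶ H, piL H = conv (𝟙 H) lam ∧ piR H = conv lam (𝟙 H) ∧ conv lam (piL H) = lam ∧
      conv (piR H) lam = lam ∧ δ[H] ≫ leftExt (δ[H] ≫ lam ▷ H) = δ[H] ≫ piL H ▷ H ∧
      (δ[H] ≫ lam ▷ H) ≫ leftExt δ[H] = δ[H] ≫ piR H ▷ H := by
  obtain ⟨h₁, h₂⟩ := generalizedInverse_of_isIso (b := galoisBeta H) L1 R1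
    (by rw [omegaL1_eq, galoisBeta_eq, leftExt_comp, comul_piL_leftExt_comul hb1 hb2 hb3])
    (by rw [omegaR1_eq, galoisBeta_eq, leftExt_comp, comul_leftExt_piR hb1 hb2 hb3])
  have h₃ : omegaR1 H ≫ R1.q ≫ inv (L1.j ≫ galoisBeta H ≫ R1.q) ≫ L1.j =
      R1.q ≫ inv (L1.j ≫ galoisBeta H ≫ R1.q) ≫ L1.j := by
    rw [← Category.assoc, R1.q_comp]
  have h₄ : (R1.q ≫ inv (L1.j ≫ galoisBeta H ≫ R1.q) ≫ L1.j) ≫ omegaL1 H =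
      R1.q ≫ inv (L1.j ≫ galoisBeta H ≫ R1.q) ≫ L1.j := by
    rw [Category.assoc, Category.assoc, L1.j_comp]
  generalize R1.q ≫ inv (L1.j ≫ galoisBeta H ≫ R1.q) ≫ L1.j = ψ at *
  have hψ := eq_leftExt (linear_of_generalizedInverse (tensorLeft H)
    (omegaL1_eq (H := H) ▸ leftExt_linear _) (omegaR1_eq (H := H) ▸ leftExt_linear _)
    (leftExt_linear _) h₁ h₂ h₃ h₄)
  rw [hψ, almostRightColinear_leftExt_iff] at h
  generalize (λ_ H).inv ≫ η[H] ▷ H ≫ ψ = f at *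
  -- Almost colinearity now reads `f = (lam ⊗ H) ∘ δ`, so `f` can be eliminated in favour of the
  -- candidate `lam`.
  generalize f ≫ H ◁ ε[H] ≫ (ρ_ H).hom = lam at *
  subst h
  subst hψ
  rw [galoisBeta_eq, leftExt_comp, omegaL1_eq] at h₁
  rw [galoisBeta_eq, leftExt_comp, omegaR1_eq] at h₂
  rw [omegaR1_eq, leftExt_comp] at h₃
  rw [omegaL1_eq, leftExt_comp] at h₄
  replace h₁ := leftExt_injective h₁
  replace h₂ := leftExt_injective h₂
  replace h₃ := leftExt_injective h₃
  replace h₄ := leftExt_injective h₄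
  refine ⟨lam, ?_, ?_, ?_, ?_, h₁, h₂⟩
  · rw [← comul_leftExt_counit, ← comul_whiskerRight_counit (piL H), ← h₁]; simp
  · rw [← comul_leftExt_counit, ← comul_whiskerRight_counit (piR H), ← h₂]; simp
  · rw [← comul_leftExt_counit, h₄, comul_whiskerRight_counit]
  · rw [← comul_leftExt_counit, h₃, comul_whiskerRight_counit]

end LeftExt

end WeakHopf

/-! ### The mirror image: right linear maps, `γ`, and the right antipode candidate. -/

namespace WeakHopf
variable {C : Type u} [Category.{v} C] [MonoidalCategory C] {H : C}

section RightExt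
variable [MonObj H]

lemma unit_rightExt (f : H ⟶ H ⊗ H) : (ρ_ H).inv ≫ H ◁ η[H] ≫ rightExt f = f := by
  calc
    _ = f ≫ (ρ_ _).inv ≫ ((H ⊗ H) ◁ η[H] ≫ (α_ H H H).hom ≫ H ◁ μ[H]) := by
      simp [rightExt, whisker_exchange_assoc]
    _ = f := by
      rw [associator_naturality_right_assoc, ← whiskerLeft_comp, MonObj.mul_one]
      simp

lemma rightExt_injective {f g : H ⟶ H ⊗ H} (h : rightExt f = rightExt g) : f = g := by
  rw [← unit_rightExt f, h, unit_rightExt]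

lemma rightExt_linear (f : H ⟶ H ⊗ H) : ((α_ H H H).hom ≫ H ◁ μ[H]) ≫ rightExt f =
    rightExt f ▷ H ≫ (α_ H H H).hom ≫ H ◁ μ[H] := by
  calc
    _ = 𝟙 _ ⊗≫ (H ◁ μ[H] ≫ f ▷ H) ⊗≫ H ◁ μ[H] ⊗≫ 𝟙 _ := by
      dsimp only [rightExt]; monoidal
    _ = 𝟙 _ ⊗≫ f ▷ H ▷ H ⊗≫ H ◁ ((α_ H H H).hom ≫ H ◁ μ[H] ≫ μ[H]) ⊗≫ 𝟙 _ := by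
      rw [whisker_exchange]; monoidal
    _ = _ := by
      rw [← MonObj.mul_assoc]
      dsimp only [rightExt]; monoidal

lemma eq_rightExt {ψ : H ⊗ H ⟶ H ⊗ H} (h : ((α_ H H H).hom ≫ H ◁ μ[H]) ≫ ψ =
    ψ ▷ H ≫ (α_ H H H).hom ≫ H ◁ μ[H]) : ψ = rightExt ((ρ_ H).inv ≫ H ◁ η[H] ≫ ψ) := by
  calc
    ψ = 𝟙 _ ⊗≫ H ◁ (η[H] ▷ H ≫ μ[H]) ⊗≫ ψ := by
      rw [MonObj.one_mul]; monoidal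
    _ = 𝟙 _ ⊗≫ (H ◁ η[H]) ▷ H ≫ ((α_ H H H).hom ≫ H ◁ μ[H]) ≫ ψ := by monoidal
    _ = _ := by rw [h]; dsimp only [rightExt]; monoidal

lemma rightExt_comp (f g : H ⟶ H ⊗ H) : rightExt f ≫ rightExt g = rightExt (f ≫ rightExt g) := by
  have h := rightExt_linear g
  rw [rightExt, Category.assoc, h, ← comp_whiskerRight_assoc]
  rfl

variable [CounitalComagma H]

lemma rightExt_counit (f : H ⟶ H ⊗ H) : rightExt f ≫ ε[H] ▷ H ≫ (λ_ H).hom =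
    (f ≫ ε[H] ▷ H ≫ (λ_ H).hom) ▷ H ≫ μ[H] := by
  calc
    _ = f ▷ H ⊗≫ (H ◁ μ[H] ≫ ε[H] ▷ H) ⊗≫ 𝟙 _ := by
      dsimp only [rightExt]; monoidal
    _ = _ := by rw [whisker_exchange]; monoidal

omit [MonObj H] in
lemma comul_whiskerLeft_counit (g : H ⟶ H) :
    (δ[H] ≫ H ◁ g) ≫ ε[H] ▷ H ≫ (λ_ H).hom = g := by
  rw [Category.assoc, whisker_exchange_assoc, leftUnitor_naturality,
    reassoc_of% CounitalComagma.counit_comul (X := H)]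

lemma comul_rightExt_counit (f g : H ⟶ H) :
    ((δ[H] ≫ H ◁ f) ≫ rightExt (δ[H] ≫ H ◁ g)) ≫ ε[H] ▷ H ≫ (λ_ H).hom = conv g f := by
  rw [Category.assoc, rightExt_counit, comul_whiskerLeft_counit, conv,
    MonoidalCategory.tensorHom_def']
  simp

lemma almostLeftColinear_rightExt_iff (f : H ⟶ H ⊗ H) : AlmostLeftColinear (rightExt f) ↔
    f = δ[H] ≫ H ◁ (f ≫ ε[H] ▷ H ≫ (λ_ H).hom) := by
  have h : δ[H] ▷ H ≫ (α_ H H H).hom ≫ H ◁ rightExt f ≫ H ◁ (ε[H] ▷ H) ≫ H ◁ (λ_ H).hom =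
      rightExt (δ[H] ≫ H ◁ (f ≫ ε[H] ▷ H ≫ (λ_ H).hom)) := by
    rw [← whiskerLeft_comp, ← whiskerLeft_comp, rightExt_counit]
    dsimp only [rightExt]; monoidal
  rw [AlmostLeftColinear, h]
  exact ⟨rightExt_injective, congrArg rightExt⟩

lemma galoisGamma_eq : galoisGamma H = rightExt δ[H] := rfl

variable [BraidedCategory C]

lemma omegaL2_eq : omegaL2 H = rightExt (δ[H] ≫ H ◁ piL H) := by
  dsimp only [omegaL2, rightExt]; monoidal

lemma omegaR2_eq : omegaR2 H = rightExt (δ[H] ≫ H ◁ piR H) := by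
  dsimp only [omegaR2, rightExt]; monoidal

lemma right_piR_iff (lam : H ⟶ H) : (δ[H] ≫ δ[H] ▷ H ≫ (α_ H H H).hom ≫ H ◁ (lam ▷ H) ≫
    H ◁ μ[H] = δ[H] ≫ H ◁ piR H) ↔ δ[H] ≫ rightExt (δ[H] ≫ H ◁ lam) = δ[H] ≫ H ◁ piR H := by
  simp [rightExt]

lemma right_piL_iff (lam : H ⟶ H) : (δ[H] ≫ (δ[H] ⊗ₘ lam) ≫ (α_ H H H).hom ≫ H ◁ μ[H] =
    δ[H] ≫ H ◁ piL H) ↔ (δ[H] ≫ H ◁ lam) ≫ rightExt δ[H] = δ[H] ≫ H ◁ piL H := by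
  simp [rightExt, MonoidalCategory.tensorHom_def']

variable (hb1 : CondB1 H) (hb2 : CondB2 H) (hb3 : CondB3 H)
include hb1 hb2 hb3

lemma comul_piL_rightExt {lam : H ⟶ H} (h : conv lam (piL H) = lam) :
    (δ[H] ≫ H ◁ piL H) ≫ rightExt (δ[H] ≫ H ◁ lam) = δ[H] ≫ H ◁ lam := by
  have h₁ := comul_piL_comul_map hb1 hb2 hb3 =≫ ((H ◁ lam) ▷ H ≫ (α_ H H H).hom ≫ H ◁ μ[H])
  simp only [Category.assoc] at h₁
  conv_rhs => rw [← h, conv, MonoidalCategory.tensorHom_def']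
  simp only [rightExt, comp_whiskerRight, Category.assoc, h₁]
  monoidal

lemma exists_isIso_of_isAntipode_right (L2 : Splitting (omegaL2 H)) (R2 : Splitting (omegaR2 H))
    {lam : H ⟶ H} (hl : IsAntipode H lam) :
    ∃ _ : IsIso (R2.j ≫ galoisGamma H ≫ L2.q),
      AlmostLeftColinear (L2.q ≫ inv (R2.j ≫ galoisGamma H ≫ L2.q) ≫ R2.j) := by
  obtain ⟨hi, h⟩ := exists_isIso_of_generalizedInverse (b := galoisGamma H)
    (b' := rightExt (δ[H] ≫ H ◁ lam)) R2 L2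
    (by rw [galoisGamma_eq, rightExt_comp, (right_piR_iff lam).1 hl.right_piR, omegaR2_eq])
    (by rw [galoisGamma_eq, rightExt_comp, (right_piL_iff lam).1 hl.right_piL, omegaL2_eq])
    (by rw [omegaL2_eq, rightExt_comp, comul_piL_rightExt hb1 hb2 hb3 hl.conv_piL])
  refine ⟨hi, ?_⟩
  rw [h, almostLeftColinear_rightExt_iff, comul_whiskerLeft_counit]

/-- Besides the two axioms attached to `γ`, only the two convolution identities used in comparing
with the left candidate are recorded. -/
lemma exists_antipode_right (L2 : Splitting (omegaL2 H)) (R2 : Splitting (omegaR2 H))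
    [IsIso (R2.j ≫ galoisGamma H ≫ L2.q)]
    (h : AlmostLeftColinear (L2.q ≫ inv (R2.j ≫ galoisGamma H ≫ L2.q) ≫ R2.j)) :
    ∃ lam : H ⟶ H, piL H = conv (𝟙 H) lam ∧ conv (piR H) lam = lam ∧
      δ[H] ≫ rightExt (δ[H] ≫ H ◁ lam) = δ[H] ≫ H ◁ piR H ∧
      (δ[H] ≫ H ◁ lam) ≫ rightExt δ[H] = δ[H] ≫ H ◁ piL H := by
  obtain ⟨h₁, h₂⟩ := generalizedInverse_of_isIso (b := galoisGamma H) R2 L2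
    (by rw [omegaR2_eq, galoisGamma_eq, rightExt_comp, comul_piR_rightExt_comul hb1 hb2 hb3])
    (by rw [omegaL2_eq, galoisGamma_eq, rightExt_comp, comul_rightExt_piL hb1 hb2 hb3])
  have h₃ : omegaL2 H ≫ L2.q ≫ inv (R2.j ≫ galoisGamma H ≫ L2.q) ≫ R2.j =
      L2.q ≫ inv (R2.j ≫ galoisGamma H ≫ L2.q) ≫ R2.j := by
    rw [← Category.assoc, L2.q_comp]
  have h₄ : (L2.q ≫ inv (R2.j ≫ galoisGamma H ≫ L2.q) ≫ R2.j) ≫ omegaR2 H =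
      L2.q ≫ inv (R2.j ≫ galoisGamma H ≫ L2.q) ≫ R2.j := by
    rw [Category.assoc, Category.assoc, R2.j_comp]
  generalize L2.q ≫ inv (R2.j ≫ galoisGamma H ≫ L2.q) ≫ R2.j = φ at *
  have hφ := eq_rightExt (linear_of_generalizedInverse (tensorRight H)
    (omegaR2_eq (H := H) ▸ rightExt_linear _) (omegaL2_eq (H := H) ▸ rightExt_linear _)
    (rightExt_linear _) h₁ h₂ h₃ h₄)
  rw [hφ, almostLeftColinear_rightExt_iff] at h
  generalize (ρ_ H).inv ≫ H ◁ η[H] ≫ φ = f at *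
  generalize f ≫ ε[H] ▷ H ≫ (λ_ H).hom = lam at *
  subst h
  subst hφ
  rw [galoisGamma_eq, rightExt_comp, omegaR2_eq] at h₁
  rw [galoisGamma_eq, rightExt_comp, omegaL2_eq] at h₂
  rw [omegaR2_eq, rightExt_comp] at h₄
  replace h₁ := rightExt_injective h₁
  replace h₂ := rightExt_injective h₂
  replace h₄ := rightExt_injective h₄
  refine ⟨lam, ?_, ?_, h₁, h₂⟩
  · rw [← comul_rightExt_counit, ← comul_whiskerLeft_counit (piL H), ← h₂]; simp
  · rw [← comul_rightExt_counit, h₄, comul_whiskerLeft_counit]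

end RightExt

/-- A left and a right antipode agree. -/
lemma left_antipode_eq_right [MonObj H] [CounitalComagma H] {p q lam lam' : H ⟶ H}
    (h : (δ[H] ≫ lam ▷ H) ≫ leftExt δ[H] = δ[H] ≫ q ▷ H) (h₁ : conv lam p = lam)
    (h₂ : p = conv (𝟙 H) lam') (h₃ : conv q lam' = lam') : lam = lam' := by
  have h' := h =≫ (H ◁ lam' ≫ μ[H])
  calc
    -- The usual `lam * (id * lam') = (lam * id) * lam'`, with `h` in place of coassociativity:
    -- after rebracketing the product, the terms `lam(b₁)b₂₁ ⊗ b₂₂` become `q(b₁) ⊗ b₂`.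
    lam = 𝟙 _ ⊗≫ (δ[H] ≫ lam ▷ H) ⊗≫ H ◁ (δ[H] ≫ H ◁ lam') ⊗≫ H ◁ μ[H] ≫ μ[H] := by
      conv_lhs => rw [← h₁, h₂, conv, conv, MonoidalCategory.tensorHom_def, id_tensorHom]
      monoidal
    _ = 𝟙 _ ⊗≫ (δ[H] ≫ lam ▷ H) ⊗≫ H ◁ (δ[H] ≫ H ◁ lam') ⊗≫
        ((α_ H H H).hom ≫ H ◁ μ[H] ≫ μ[H]) := by monoidal
    _ = 𝟙 _ ⊗≫ (δ[H] ≫ lam ▷ H) ⊗≫ H ◁ δ[H] ⊗≫ ((H ⊗ H) ◁ lam' ≫ μ[H] ▷ H) ≫ μ[H] := by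
      rw [← MonObj.mul_assoc]; monoidal
    _ = ((δ[H] ≫ lam ▷ H) ≫ leftExt δ[H]) ≫ H ◁ lam' ≫ μ[H] := by
      rw [whisker_exchange]; dsimp only [leftExt]; monoidal
    _ = lam' := by
      conv_rhs => rw [← h₃, conv, MonoidalCategory.tensorHom_def]
      rw [h']
      simp only [Category.assoc]

end WeakHopf

theorem theorem3 {C : Type u} [Category.{v} C] [MonoidalCategory C] [BraidedCategory C]
    [HasEqualizers C] [HasCoequalizers C] (H : C) [MonObj H] [CounitalComagma H]
    (hb1 : WeakHopf.CondB1 H) (hb2 : WeakHopf.CondB2 H) (hb3 : WeakHopf.CondB3 H) :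
    -- the four idempotents split, so the objects below exist
    (Nonempty (Splitting (WeakHopf.omegaL1 H)) ∧ Nonempty (Splitting (WeakHopf.omegaR1 H)) ∧
      Nonempty (Splitting (WeakHopf.omegaL2 H)) ∧ Nonempty (Splitting (WeakHopf.omegaR2 H))) ∧
    -- for every choice of the splittings `(obj, j, q)`
    ∀ (L1 : Splitting (WeakHopf.omegaL1 H)) (R1 : Splitting (WeakHopf.omegaR1 H))
      (L2 : Splitting (WeakHopf.omegaL2 H)) (R2 : Splitting (WeakHopf.omegaR2 H))
      (h : R2.obj ⟶ L2.obj) (s : L1.obj ⟶ R1.obj),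
      h = R2.j ≫ WeakHopf.galoisGamma H ≫ L2.q →
      s = L1.j ≫ WeakHopf.galoisBeta H ≫ R1.q →
      (WeakHopf.IsWeakHopfCoquasigroup H ↔
        ∃ (_ : IsIso h) (_ : IsIso s),
          WeakHopf.AlmostLeftColinear (L2.q ≫ inv h ≫ R2.j) ∧
          WeakHopf.AlmostRightColinear (R1.q ≫ inv s ≫ L1.j)) := by
  open WeakHopf in
  refine ⟨⟨Splitting.nonempty_of_idem ?_, Splitting.nonempty_of_idem ?_,
    Splitting.nonempty_of_idem ?_, Splitting.nonempty_of_idem ?_⟩, ?_⟩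
  · rw [omegaL1_eq, leftExt_comp, comul_piL_leftExt_self hb1 hb2 hb3]
  · rw [omegaR1_eq, leftExt_comp, comul_piR_leftExt_self hb1 hb2 hb3]
  · rw [omegaL2_eq, rightExt_comp, comul_piL_rightExt_self hb1 hb2 hb3]
  · rw [omegaR2_eq, rightExt_comp, comul_piR_rightExt_self hb1 hb2 hb3]
  · rintro L1 R1 L2 R2 h s rfl rfl
    constructor
    · rintro ⟨-, -, -, lam, hl⟩
      obtain ⟨hi, hc⟩ := exists_isIso_of_isAntipode_right hb1 hb2 hb3 L2 R2 hl
      obtain ⟨hi', hc'⟩ := exists_isIso_of_isAntipode_left hb1 hb2 hb3 L1 R1 hl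
      exact ⟨hi, hi', hc, hc'⟩
    · rintro ⟨hi, hi', hc, hc'⟩
      obtain ⟨lam, h₁, h₂, h₃, h₄, h₅, h₆⟩ := exists_antipode_left hb1 hb2 hb3 L1 R1 hc'
      obtain ⟨lam', h₁', h₄', h₅', h₆'⟩ := exists_antipode_right hb1 hb2 hb3 L2 R2 hc
      obtain rfl := left_antipode_eq_right h₆ h₃ h₁' h₄'
      exact ⟨hb1, hb2, hb3, lam, h₁, h₂, h₃, h₄, (left_piR_iff lam).2 h₆,
        (left_piL_iff lam).2 h₅, (right_piL_iff lam).2 h₆', (right_piR_iff lam).2 h₅'⟩
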